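/- Let $\varepsilon>0$, $\tau>0$, let $H=H(U^2,V)$ and $G=G(V)$ be smooth real functions with $G(0)=0$, and put $H_0=H(1,0)$, $G_1=G'(0)$. Consider, in the variable $\xi=x/\varepsilon\in\mathbb R$, the system $$U_t=U_{\xi\xi}+(1+V-U^2)U,\qquad \varepsilon^2\tau V_t=V_{\xi\xi}+\varepsilon^2\big[(1+V-U^2)H(U^2,V)+G(V)\big],$$ and let $(U_h,V_h)$ be a stationary front, i.e. a $C^2$ stationary solution with $U_h(\xi)\to\pm1$ and $V_h(\xi)\to0$ as $\xi\to\pm\infty$. Let $L$ be the linearized operator about the front, $L(u,v)=(f,g)$ with $$f=u_{\xi\xi}+(1+V_h-3U_h^2)u+U_hv,$$ $$g=\frac1{\varepsilon^2\tau}\Big\{v_{\xi\xi}-2\varepsilon^2\Big[H-(1+V_h-U_h^2)\frac{\partial H}{\partial U^2}\Big]U_hu+\varepsilon^2\Big[H+(1+V_h-U_h^2)\frac{\partial H}{\partial V}+G'(V_h)\Big]v\Big\},$$ where $H$ and its partial derivatives with respect to its first and second arguments are evaluated at $(U_h^2,V_h)$. Consider $L$ as an unbounded operator on $BUC(\mathbb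 R;\mathbb C)^2$ (bounded uniformly continuous functions with the supremum norm) whose domain consists of all pairs of $C^2$ functions in the space that $L$ maps into the space. Let its essential spectrum $\sigma_{\rm ess}$ be the set of $\lambda\in\mathbb C$ for which $L-\lambda$ is not a Fredholm operator of index $0$. Then $$\sigma_{\rm ess}=\{\lambda\in\mathbb C:\ Q(\lambda,k)=0\ \text{for some }k\in\mathbb R\},$$ $$Q(\lambda,k)=(\lambda+k^2+2)\big(\varepsilon^2\tau\lambda+k^2-\varepsilon^2(H_0+G_1)\big)+2\varepsilon^2H_0 .$$ Moreover, if $\varepsilon$ is so small that $\varepsilon^2\tau\le1$, and if $G_1<0$ and $H_0+G_1-2\tau<0$, then $\sigma_{\rm ess}\subset\{\lambda\in\mathbb C:\operatorname{Re}\lambda<0\}$. -/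

import Mathlib

open Filter Topology
open scoped BoundedContinuousFunction ContDiff

noncomputable section

/-! ### Fredholm operators and the essential spectrum of an unbounded operator -/

/-- The linear map `T - z` on the domain of a (possibly unbounded) operator `T` in `E`. -/
def LinearPMap.shift {E : Type*} [NormedAddCommGroup E] [NormedSpace ℂ E]
    (T : E →ₗ.[ℂ] E) (z : ℂ) : T.domain →ₗ[ℂ] E :=
  T.toFun - z • T.domain.subtype

/-- A linear map into a normed space (in the applications: a closed operator, given on its domain)
is Fredholm of index zero if its kernel is finite-dimensional, its range is closed and of finite
codimension, and the dimension of the kernel equals the codimension of the range. -/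
def IsFredholmIndexZero {D E : Type*} [AddCommGroup D] [Module ℂ D]
    [NormedAddCommGroup E] [NormedSpace ℂ E] (A : D →ₗ[ℂ] E) : Prop :=
  FiniteDimensional ℂ (LinearMap.ker A) ∧
  IsClosed (LinearMap.range A : Set E) ∧
  FiniteDimensional ℂ (E ⧸ LinearMap.range A) ∧
  Module.finrank ℂ (LinearMap.ker A) = Module.finrank ℂ (E ⧸ LinearMap.range A)

/-- The essential spectrum of `T`: all `z` for which `T - z` is not Fredholm of index zero. -/
def essentialSpectrum {E : Type*} [NormedAddCommGroup E] [NormedSpace ℂ E]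
    (T : E →ₗ.[ℂ] E) : Set ℂ :=
  {z | ¬ IsFredholmIndexZero (T.shift z)}

/-! ### The phase space -/

/-- `BUC(ℝ)`: the bounded uniformly continuous functions `ℝ → ℂ`, with the supremum norm. -/
def BUC : Submodule ℂ (ℝ →ᵇ ℂ) where
  carrier := {f | UniformContinuous f}
  add_mem' := fun {f g} hf hg => by
    have h : UniformContinuous (fun x => f x + g x) := UniformContinuous.add hf hg
    exact h
  zero_mem' := by
    have h : UniformContinuous (fun _ : ℝ => (0 : ℂ)) := uniformContinuous_const
    exact h
  smul_mem' := fun c f hf => by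
    have h : UniformContinuous (fun x => c • f x) := UniformContinuous.const_smul hf c
    exact h

/-- Pairs `(u, v)` of perturbations of the `U`- and the `V`-component. -/
abbrev PhaseSpace : Type := BUC × BUC

/-! ### The reaction-diffusion system, its fronts and the linearization about them

In the variable `ξ = x / ε` the system is
`U_t = U_ξξ + (1 + V - U²) U`,
`ε² τ V_t = V_ξξ + ε² [(1 + V - U²) H(U², V) + G(V)]`. -/

/-- The reaction term of the `V`-equation. -/
def reactionV (H : ℝ → ℝ → ℝ) (G : ℝ → ℝ) (U V : ℝ) : ℝ :=
  (1 + V - U ^ 2) * H (U ^ 2) V + G V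

/-- `(U_h, V_h)` is a stationary front connecting the background states `(-1, 0)` and `(1, 0)`. -/
structure IsFront (ε : ℝ) (H : ℝ → ℝ → ℝ) (G : ℝ → ℝ) (Uh Vh : ℝ → ℝ) : Prop where
  contDiff_U : ContDiff ℝ 2 Uh
  contDiff_V : ContDiff ℝ 2 Vh
  eq_U : ∀ ξ, iteratedDeriv 2 Uh ξ + (1 + Vh ξ - Uh ξ ^ 2) * Uh ξ = 0
  eq_V : ∀ ξ, iteratedDeriv 2 Vh ξ + ε ^ 2 * reactionV H G (Uh ξ) (Vh ξ) = 0
  tendsto_U_atTop : Tendsto Uh atTop (𝓝 1)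
  tendsto_U_atBot : Tendsto Uh atBot (𝓝 (-1))
  tendsto_V_atTop : Tendsto Vh atTop (𝓝 0)
  tendsto_V_atBot : Tendsto Vh atBot (𝓝 0)

/-- `∂/∂U` of the reaction term of the `V`-equation at `(U, V)`, where `∂H/∂U²` is the partial
derivative of `H` in its first argument. -/
def coeffU (H : ℝ → ℝ → ℝ) (U V : ℝ) : ℝ :=
  -(2 * (H (U ^ 2) V - (1 + V - U ^ 2) * deriv (fun s => H s V) (U ^ 2)) * U)

/-- `∂/∂V` of the reaction term of the `V`-equation at `(U, V)`. -/
def coeffV (H : ℝ → ℝ → ℝ) (G : ℝ → ℝ) (U V : ℝ) : ℝ :=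
  H (U ^ 2) V + (1 + V - U ^ 2) * deriv (fun w => H (U ^ 2) w) V + deriv G V

/-- `coeffU` is the partial derivative of the reaction term with respect to `U`. -/
theorem hasDerivAt_reactionV_U {H : ℝ → ℝ → ℝ} (hH : ContDiff ℝ ∞ (Function.uncurry H))
    (G : ℝ → ℝ) (U V : ℝ) :
    HasDerivAt (fun x => reactionV H G x V) (coeffU H U V) U := by
  have h1 : Differentiable ℝ (fun s => H s V) := by
    have h : ContDiff ℝ ∞ (fun s : ℝ => Function.uncurry H (s, V)) := by fun_prop
    exact h.differentiable (by simp)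
  have h2 : HasDerivAt (fun x : ℝ => x ^ 2) (2 * U) U := by
    simpa using hasDerivAt_pow 2 U
  have h3 := HasDerivAt.comp U (h1 (U ^ 2)).hasDerivAt h2
  have h4 := ((h2.const_sub (1 + V)).mul h3).add_const (G V)
  refine h4.congr_deriv ?_
  simp only [coeffU, Function.comp_apply]
  ring

/-- `coeffV` is the partial derivative of the reaction term with respect to `V`. -/
theorem hasDerivAt_reactionV_V {H : ℝ → ℝ → ℝ} (hH : ContDiff ℝ ∞ (Function.uncurry H))
    {G : ℝ → ℝ} (hG : ContDiff ℝ ∞ G) (U V : ℝ) :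
    HasDerivAt (fun y => reactionV H G U y) (coeffV H G U V) V := by
  have h1 : Differentiable ℝ (fun w => H (U ^ 2) w) := by
    have h : ContDiff ℝ ∞ (fun w : ℝ => Function.uncurry H (U ^ 2, w)) := by fun_prop
    exact h.differentiable (by simp)
  have h2 : HasDerivAt (fun y : ℝ => 1 + y - U ^ 2) 1 V :=
    ((hasDerivAt_id V).const_add 1).sub_const (U ^ 2)
  have h4 := (h2.mul (h1 V).hasDerivAt).add ((hG.differentiable (by simp)) V).hasDerivAt
  refine h4.congr_deriv ?_
  simp only [coeffV]
  ring

/-- First component of the linearization about `(U_h, V_h)`, applied to `(u, v)`. -/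
def linU (Uh Vh : ℝ → ℝ) (u v : ℝ → ℂ) (ξ : ℝ) : ℂ :=
  iteratedDeriv 2 u ξ + ((1 + Vh ξ - 3 * Uh ξ ^ 2 : ℝ) : ℂ) * u ξ + ((Uh ξ : ℝ) : ℂ) * v ξ

/-- Second component of the linearization about `(U_h, V_h)`, applied to `(u, v)`, after division
by the factor `ε² τ` of the time derivative. -/
def linV (ε τ : ℝ) (H : ℝ → ℝ → ℝ) (G : ℝ → ℝ) (Uh Vh : ℝ → ℝ) (u v : ℝ → ℂ) (ξ : ℝ) : ℂ :=
  ((ε ^ 2 * τ : ℝ) : ℂ)⁻¹ * (iteratedDeriv 2 v ξ + ((ε ^ 2 : ℝ) : ℂ) *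
    (((coeffU H (Uh ξ) (Vh ξ) : ℝ) : ℂ) * u ξ + ((coeffV H G (Uh ξ) (Vh ξ) : ℝ) : ℂ) * v ξ))

theorem linU_add (Uh Vh : ℝ → ℝ) {u v u' v' : ℝ → ℂ} (hu : ContDiff ℝ 2 u)
    (hu' : ContDiff ℝ 2 u') (ξ : ℝ) :
    linU Uh Vh (fun x => u x + u' x) (fun x => v x + v' x) ξ
      = linU Uh Vh u v ξ + linU Uh Vh u' v' ξ := by
  have h : iteratedDeriv 2 (fun x => u x + u' x) ξ = iteratedDeriv 2 u ξ + iteratedDeriv 2 u' ξ :=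
    iteratedDeriv_fun_add hu.contDiffAt hu'.contDiffAt
  simp only [linU, h]
  ring

theorem linU_smul (Uh Vh : ℝ → ℝ) (c : ℂ) {u v : ℝ → ℂ} (ξ : ℝ) :
    linU Uh Vh (fun x => c * u x) (fun x => c * v x) ξ = c * linU Uh Vh u v ξ := by
  have h : iteratedDeriv 2 (fun x => c * u x) ξ = c * iteratedDeriv 2 u ξ :=
    iteratedDeriv_const_mul_field c u
  simp only [linU, h]
  ring

theorem linV_add (ε τ : ℝ) (H : ℝ → ℝ → ℝ) (G : ℝ → ℝ) (Uh Vh : ℝ → ℝ) {u v u' v' : ℝ → ℂ}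
    (hv : ContDiff ℝ 2 v) (hv' : ContDiff ℝ 2 v') (ξ : ℝ) :
    linV ε τ H G Uh Vh (fun x => u x + u' x) (fun x => v x + v' x) ξ
      = linV ε τ H G Uh Vh u v ξ + linV ε τ H G Uh Vh u' v' ξ := by
  have h : iteratedDeriv 2 (fun x => v x + v' x) ξ = iteratedDeriv 2 v ξ + iteratedDeriv 2 v' ξ :=
    iteratedDeriv_fun_add hv.contDiffAt hv'.contDiffAt
  simp only [linV, h]
  ring

theorem linV_smul (ε τ : ℝ) (H : ℝ → ℝ → ℝ) (G : ℝ → ℝ) (Uh Vh : ℝ → ℝ) (c : ℂ) {u v : ℝ → ℂ}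
    (ξ : ℝ) :
    linV ε τ H G Uh Vh (fun x => c * u x) (fun x => c * v x) ξ
      = c * linV ε τ H G Uh Vh u v ξ := by
  have h : iteratedDeriv 2 (fun x => c * v x) ξ = c * iteratedDeriv 2 v ξ :=
    iteratedDeriv_const_mul_field c v
  simp only [linV, h]
  ring

/-- `w = (u, v)` is twice continuously differentiable and the linearization maps it to `f`. -/
def IsImage (ε τ : ℝ) (H : ℝ → ℝ → ℝ) (G : ℝ → ℝ) (Uh Vh : ℝ → ℝ) (w f : PhaseSpace) : Prop :=
  ContDiff ℝ 2 (w.1 : ℝ →ᵇ ℂ) ∧ ContDiff ℝ 2 (w.2 : ℝ →ᵇ ℂ) ∧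
  ∀ ξ : ℝ, (f.1 : ℝ →ᵇ ℂ) ξ = linU Uh Vh (w.1 : ℝ →ᵇ ℂ) (w.2 : ℝ →ᵇ ℂ) ξ ∧
    (f.2 : ℝ →ᵇ ℂ) ξ = linV ε τ H G Uh Vh (w.1 : ℝ →ᵇ ℂ) (w.2 : ℝ →ᵇ ℂ) ξ

section IsImage

variable {ε τ : ℝ} {H : ℝ → ℝ → ℝ} {G : ℝ → ℝ} {Uh Vh : ℝ → ℝ}

theorem IsImage.unique {w f g : PhaseSpace} (hf : IsImage ε τ H G Uh Vh w f)
    (hg : IsImage ε τ H G Uh Vh w g) : f = g := by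
  refine Prod.ext (Subtype.ext ?_) (Subtype.ext ?_)
  · ext1 ξ
    exact ((hf.2.2 ξ).1).trans ((hg.2.2 ξ).1).symm
  · ext1 ξ
    exact ((hf.2.2 ξ).2).trans ((hg.2.2 ξ).2).symm

theorem IsImage.add {w w' f f' : PhaseSpace} (h : IsImage ε τ H G Uh Vh w f)
    (h' : IsImage ε τ H G Uh Vh w' f') : IsImage ε τ H G Uh Vh (w + w') (f + f') := by
  refine ⟨h.1.add h'.1, h.2.1.add h'.2.1, fun ξ => ⟨?_, ?_⟩⟩
  · exact (congrArg₂ (· + ·) (h.2.2 ξ).1 (h'.2.2 ξ).1).trans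
      (linU_add Uh Vh h.1 h'.1 ξ).symm
  · exact (congrArg₂ (· + ·) (h.2.2 ξ).2 (h'.2.2 ξ).2).trans
      (linV_add ε τ H G Uh Vh h.2.1 h'.2.1 ξ).symm

theorem IsImage.smul (c : ℂ) {w f : PhaseSpace} (h : IsImage ε τ H G Uh Vh w f) :
    IsImage ε τ H G Uh Vh (c • w) (c • f) := by
  refine ⟨h.1.const_smul c, h.2.1.const_smul c, fun ξ => ⟨?_, ?_⟩⟩
  · exact (congrArg (c * ·) (h.2.2 ξ).1).trans (linU_smul Uh Vh c ξ).symm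
  · exact (congrArg (c * ·) (h.2.2 ξ).2).trans (linV_smul ε τ H G Uh Vh c ξ).symm

theorem IsImage.zero : IsImage ε τ H G Uh Vh 0 0 := by
  refine ⟨contDiff_const, contDiff_const, fun ξ => ⟨?_, ?_⟩⟩
  · change (0 : ℂ) = linU Uh Vh (fun _ => 0) (fun _ => 0) ξ
    simp [linU]
  · change (0 : ℂ) = linV ε τ H G Uh Vh (fun _ => 0) (fun _ => 0) ξ
    simp [linV]

end IsImage

/-- The linearized operator about `(U_h, V_h)`, as an unbounded operator in `BUC(ℝ) × BUC(ℝ)` with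
its maximal domain: all pairs of `C²` functions in the space that are mapped into the space. -/
def linearization (ε τ : ℝ) (H : ℝ → ℝ → ℝ) (G : ℝ → ℝ) (Uh Vh : ℝ → ℝ) :
    PhaseSpace →ₗ.[ℂ] PhaseSpace where
  domain :=
    { carrier := {w | ∃ f, IsImage ε τ H G Uh Vh w f}
      add_mem' := fun ⟨f, hf⟩ ⟨g, hg⟩ => ⟨f + g, hf.add hg⟩
      zero_mem' := ⟨0, IsImage.zero⟩
      smul_mem' := fun c _ ⟨f, hf⟩ => ⟨c • f, hf.smul c⟩ }
  toFun :=
    { toFun := fun w => w.2.choose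
      map_add' := fun w w' =>
        (w + w').2.choose_spec.unique (w.2.choose_spec.add w'.2.choose_spec)
      map_smul' := fun c w => (c • w).2.choose_spec.unique (w.2.choose_spec.smul c) }

/-- The characteristic function `Q(lam, k)` of the background states; `H₀ = H(1, 0)`,
`G₁ = G'(0)`. -/
def dispersion (ε τ H₀ G₁ : ℝ) (lam : ℂ) (k : ℝ) : ℂ :=
  (lam + (k : ℂ) ^ 2 + 2) *
      ((ε : ℂ) ^ 2 * (τ : ℂ) * lam + (k : ℂ) ^ 2 - (ε : ℂ) ^ 2 * ((H₀ : ℂ) + (G₁ : ℂ)))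
    + 2 * (ε : ℂ) ^ 2 * (H₀ : ℂ)

end

/-! The coefficients of `L - λ` converge at both ends, but the off-diagonal ones change sign with
`U_h`: the limit matrices at `±∞` are conjugate by `diag(1, -1)`. Multiplying the `V`-component by a
nowhere vanishing function that tends to `±1` at `±∞` makes both limits equal. A real function
cannot do this without a zero, so the unimodular `phaseFun` runs along a half circle in `ℂ`; the
price is a decaying drift and a decaying potential.

Writing both components through `(D² - 1)⁻¹` then identifies the maximal domain with the whole
space, and `L - λ` becomes, up to isomorphisms, the bounded operator `(D² + A)(D² - 1)⁻¹ + K` with a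
constant matrix `A` (`isFredholmIndexZero_shift_iff`). Here `K` consists of decaying multipliers
after smoothing operators and is a norm limit of finite rank operators
(`BUC.mulOp_comp_mem_finiteRankClosure`). The determinant of `A - k²` is `Q(λ, k)`.

If `Q(λ, ·)` has no real zero, no eigenvalue of `A` is the square of a real number, so `D² + A` can
be inverted by exponential kernels (`BUC.constOp_bijective`); an isomorphism plus `K` is Fredholm of
index zero (`isFredholmIndexZero_equiv_add`). If `Q(λ, k) = 0`, ever wider wave packets of frequency
`k` escaping to `+∞` form a bounded sequence whose images tend to zero but which has no convergent
subsequence; finite-dimensional kernel and closed range exclude this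
(`BUC.not_isFredholmIndexZero_constOp_add_pertOp`).

For the half-plane statement, `Q(λ, k)` is a quadratic polynomial in `λ` with positive coefficients,
so its roots have negative real part. -/

noncomputable section

/-! ### Fredholm operators of index zero -/

section FredholmIndexZero

variable {D D' E E' : Type*} [AddCommGroup D] [Module ℂ D] [AddCommGroup D'] [Module ℂ D']
  [NormedAddCommGroup E] [NormedSpace ℂ E] [NormedAddCommGroup E'] [NormedSpace ℂ E']

theorem IsFredholmIndexZero.comp_equiv {A : D →ₗ[ℂ] E} (hA : IsFredholmIndexZero A)
    (e : D' ≃ₗ[ℂ] D) (N : E ≃L[ℂ] E') :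
    IsFredholmIndexZero ((N : E →ₗ[ℂ] E') ∘ₗ A ∘ₗ (e : D' →ₗ[ℂ] D)) := by
  obtain ⟨h1, h2, h3, h4⟩ := hA
  have hrange : LinearMap.range ((N : E →ₗ[ℂ] E') ∘ₗ A ∘ₗ (e : D' →ₗ[ℂ] D))
      = (LinearMap.range A).map (N : E →ₗ[ℂ] E') := by
    rw [LinearMap.range_comp, LinearEquiv.range_comp]
  have hker : LinearMap.ker ((N : E →ₗ[ℂ] E') ∘ₗ A ∘ₗ (e : D' →ₗ[ℂ] D))
      = (LinearMap.ker A).comap (e : D' →ₗ[ℂ] D) := by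
    ext x
    simp
  have ek : LinearMap.ker ((N : E →ₗ[ℂ] E') ∘ₗ A ∘ₗ (e : D' →ₗ[ℂ] D)) ≃ₗ[ℂ] LinearMap.ker A :=
    (LinearEquiv.ofEq _ _ hker).trans (e.ofSubmodule' _)
  have eq : (E ⧸ LinearMap.range A) ≃ₗ[ℂ]
      (E' ⧸ LinearMap.range ((N : E →ₗ[ℂ] E') ∘ₗ A ∘ₗ (e : D' →ₗ[ℂ] D))) :=
    Submodule.Quotient.equiv _ _ N.toLinearEquiv hrange.symm
  refine ⟨ek.symm.finiteDimensional, ?_, eq.finiteDimensional, ?_⟩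
  · rw [hrange]
    exact N.toHomeomorph.isClosedMap _ h2
  · rw [ek.finrank_eq, h4, eq.finrank_eq]

theorem isFredholmIndexZero_comp_equiv_iff {A : D →ₗ[ℂ] E} (e : D' ≃ₗ[ℂ] D) (N : E ≃L[ℂ] E') :
    IsFredholmIndexZero ((N : E →ₗ[ℂ] E') ∘ₗ A ∘ₗ (e : D' →ₗ[ℂ] D)) ↔ IsFredholmIndexZero A := by
  refine ⟨fun h => ?_, fun h => h.comp_equiv e N⟩
  have h' := h.comp_equiv e.symm N.symm
  convert h' using 1
  ext x
  simp

/-- The identity plus a bounded operator of finite rank is Fredholm of index zero. -/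
theorem isFredholmIndexZero_id_add_finiteRank (F : E →L[ℂ] E)
    [FiniteDimensional ℂ (LinearMap.range (F : E →ₗ[ℂ] E))] :
    IsFredholmIndexZero ((ContinuousLinearMap.id ℂ E + F : E →L[ℂ] E) : E →ₗ[ℂ] E) := by
  set V := LinearMap.range (F : E →ₗ[ℂ] E) with hV
  set A : E →ₗ[ℂ] E := ((ContinuousLinearMap.id ℂ E + F : E →L[ℂ] E) : E →ₗ[ℂ] E) with hA
  have hAx : ∀ x, A x = x + F x := fun x => rfl
  have hFV : ∀ x, F x ∈ V := fun x => ⟨x, rfl⟩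
  have hmaps : ∀ x ∈ V, A x ∈ V := fun x hx => V.add_mem hx (hFV x)
  have hback : ∀ x, A x ∈ V → x ∈ V := fun x hx => by
    have := V.sub_mem hx (hFV x)
    rwa [hAx, add_sub_cancel_right] at this
  -- Kernel and cokernel of `1 + F` agree with those of its restriction to the finite-dimensional
  -- space `V = range F`, where rank-nullity gives index zero.
  let AV : V →ₗ[ℂ] V := A.restrict hmaps
  have hkerle : LinearMap.ker A ≤ V := fun x hx => hback x (by rw [LinearMap.mem_ker.1 hx]; simp)
  have hker : LinearMap.ker AV = (LinearMap.ker A).comap V.subtype := by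
    ext x
    simp only [LinearMap.mem_ker, Submodule.mem_comap, Submodule.subtype_apply]
    rw [Subtype.ext_iff]
    rfl
  have ek : LinearMap.ker AV ≃ₗ[ℂ] LinearMap.ker A :=
    (LinearEquiv.ofEq _ _ hker).trans (Submodule.comapSubtypeEquivOfLe hkerle)
  let q : V →ₗ[ℂ] E ⧸ LinearMap.range A := (LinearMap.range A).mkQ ∘ₗ V.subtype
  have hqker : LinearMap.ker q = LinearMap.range AV := by
    ext x
    simp only [q, LinearMap.mem_ker, LinearMap.comp_apply, Submodule.subtype_apply,
      Submodule.mkQ_apply, Submodule.Quotient.mk_eq_zero, LinearMap.mem_range]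
    constructor
    · rintro ⟨y, hy⟩
      exact ⟨⟨y, hback y (hy ▸ x.2)⟩, Subtype.ext hy⟩
    · rintro ⟨y, hy⟩
      exact ⟨y, congrArg Subtype.val hy⟩
  have hqsurj : Function.Surjective q := by
    intro z
    obtain ⟨x, rfl⟩ := Submodule.mkQ_surjective _ z
    refine ⟨⟨-F x, V.neg_mem (hFV x)⟩, ?_⟩
    simp only [q, LinearMap.comp_apply, Submodule.subtype_apply, Submodule.mkQ_apply]
    rw [Submodule.Quotient.eq]
    exact ⟨-x, by rw [map_neg, hAx]; abel⟩
  have eq : (V ⧸ LinearMap.range AV) ≃ₗ[ℂ] (E ⧸ LinearMap.range A) :=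
    (Submodule.quotEquivOfEq _ _ hqker.symm).trans (q.quotKerEquivOfSurjective hqsurj)
  have : FiniteDimensional ℂ (E ⧸ LinearMap.ker (F : E →ₗ[ℂ] E)) :=
    (F : E →ₗ[ℂ] E).quotKerEquivRange.symm.finiteDimensional
  refine ⟨ek.finiteDimensional, ?_, eq.finiteDimensional, ?_⟩
  -- The range contains `ker F`, on which `1 + F` is the identity; this subspace is closed and of
  -- finite codimension.
  · refine Submodule.isClosed_mono_of_finiteDimensional_quotient (s := LinearMap.ker (F : E →ₗ[ℂ] E))
      F.isClosed_ker fun x hx => ⟨x, ?_⟩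
    have : F x = 0 := hx
    rw [hAx, this, add_zero]
  · rw [← ek.finrank_eq, ← eq.finrank_eq]
    have h1 := LinearMap.finrank_range_add_finrank_ker AV
    have h2 := Submodule.finrank_quotient_add_finrank (LinearMap.range AV)
    omega

/-- The bounded operators that are norm limits of operators of finite rank. -/
def finiteRankClosure (E E' : Type*) [NormedAddCommGroup E] [NormedSpace ℂ E]
    [NormedAddCommGroup E'] [NormedSpace ℂ E'] : Set (E →L[ℂ] E') :=
  closure {F | FiniteDimensional ℂ (LinearMap.range (F : E →ₗ[ℂ] E'))}

theorem finiteRankClosure.add {K L : E →L[ℂ] E'} (hK : K ∈ finiteRankClosure E E')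
    (hL : L ∈ finiteRankClosure E E') : K + L ∈ finiteRankClosure E E' := by
  refine map_mem_closure₂ continuous_add hK hL fun F hF G hG => ?_
  have : FiniteDimensional ℂ (LinearMap.range (F : E →ₗ[ℂ] E')) := hF
  have : FiniteDimensional ℂ (LinearMap.range (G : E →ₗ[ℂ] E')) := hG
  exact Submodule.finiteDimensional_of_le (LinearMap.range_add_le (F : E →ₗ[ℂ] E') G)

theorem finiteRankClosure.comp {E₁ E₂ : Type*} [NormedAddCommGroup E₁] [NormedSpace ℂ E₁]
    [NormedAddCommGroup E₂] [NormedSpace ℂ E₂] {K : E →L[ℂ] E'} (hK : K ∈ finiteRankClosure E E')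
    (S : E₁ →L[ℂ] E) (T : E' →L[ℂ] E₂) : T ∘L K ∘L S ∈ finiteRankClosure E₁ E₂ := by
  have hc : Continuous fun K : E →L[ℂ] E' => T ∘L K ∘L S := by fun_prop
  refine map_mem_closure (f := fun K : E →L[ℂ] E' => T ∘L K ∘L S) hc hK fun F hF => ?_
  have : FiniteDimensional ℂ (LinearMap.range (F : E →ₗ[ℂ] E')) := hF
  have h : LinearMap.range ((T ∘L F ∘L S : E₁ →L[ℂ] E₂) : E₁ →ₗ[ℂ] E₂)
      ≤ (LinearMap.range (F : E →ₗ[ℂ] E')).map (T : E' →ₗ[ℂ] E₂) := by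
    rintro _ ⟨x, rfl⟩
    exact ⟨F (S x), ⟨S x, rfl⟩, rfl⟩
  exact Submodule.finiteDimensional_of_le h

/-- An isomorphism plus a limit of operators of finite rank is Fredholm of index zero. -/
theorem isFredholmIndexZero_equiv_add [CompleteSpace E] (B : E ≃L[ℂ] E) {K : E →L[ℂ] E}
    (hK : K ∈ finiteRankClosure E E) :
    IsFredholmIndexZero (((B : E →L[ℂ] E) + K : E →L[ℂ] E) : E →ₗ[ℂ] E) := by
  have hnhds : Set.range ((↑) : (E ≃L[ℂ] E) → E →L[ℂ] E) ∈ 𝓝 (B : E →L[ℂ] E) :=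
    ContinuousLinearEquiv.nhds B
  -- For `F` of finite rank close to `K`, the operator `C = B + (K - F)` is still invertible, and `B
  -- + K = C (1 + C⁻¹ F)`.
  have hcont : Continuous fun F : E →L[ℂ] E => (B : E →L[ℂ] E) + (K - F) := by fun_prop
  have hpre := hcont.continuousAt.preimage_mem_nhds (x := K) (by simpa using hnhds)
  obtain ⟨F, ⟨C, hC⟩, hF⟩ := mem_closure_iff_nhds.1 hK _ hpre
  have hF' : FiniteDimensional ℂ (LinearMap.range (F : E →ₗ[ℂ] E)) := hF
  let F' : E →L[ℂ] E := (C.symm : E →L[ℂ] E) ∘L F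
  have : FiniteDimensional ℂ (LinearMap.range (F' : E →ₗ[ℂ] E)) := by
    have h : LinearMap.range (F' : E →ₗ[ℂ] E)
        = (LinearMap.range (F : E →ₗ[ℂ] E)).map ((C.symm : E →L[ℂ] E) : E →ₗ[ℂ] E) :=
      LinearMap.range_comp _ _
    rw [h]
    infer_instance
  convert (isFredholmIndexZero_id_add_finiteRank F').comp_equiv (LinearEquiv.refl ℂ E) C using 1
  ext x
  have h := congrArg (fun T : E →L[ℂ] E => T x) hC
  simp only [ContinuousLinearEquiv.coe_coe, add_apply, sub_apply] at h
  simp [F', h]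
  abel

/-- A bounded sequence that is mapped to a null sequence by an operator with finite-dimensional
kernel and closed range has a convergent subsequence. -/
theorem exists_convergent_subseq_of_isFredholmIndexZero [CompleteSpace E] {S : E →L[ℂ] E}
    (hS : IsFredholmIndexZero (S : E →ₗ[ℂ] E)) {f : ℕ → E} {C : ℝ} (hf : ∀ n, ‖f n‖ ≤ C)
    (hSf : Tendsto (fun n => S (f n)) atTop (𝓝 0)) :
    ∃ (g : E) (φ : ℕ → ℕ), StrictMono φ ∧ Tendsto (f ∘ φ) atTop (𝓝 g) := by
  obtain ⟨h1, h2, -, -⟩ := hS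
  -- Split along a bounded projection `P` onto the kernel. On the complement `X = ker P` the
  -- operator is bounded below, so the `X`-components tend to zero; the kernel components stay in a
  -- compact ball.
  obtain ⟨P, hP⟩ := Submodule.ClosedComplemented.of_finiteDimensional (LinearMap.ker (S : E →ₗ[ℂ] E))
  set X := LinearMap.ker (P : E →ₗ[ℂ] LinearMap.ker (S : E →ₗ[ℂ] E)) with hX
  have hXc : IsClosed (X : Set E) := P.isClosed_ker
  have : CompleteSpace X := hXc.completeSpace_coe
  let SX : X →L[ℂ] E := S ∘L X.subtypeL
  have hdec : ∀ x, x - P x ∈ X := fun x => by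
    change P (x - P x) = 0
    rw [map_sub, hP, sub_self]
  have hSP : ∀ x, S (P x : E) = 0 := fun x => (P x).2
  have hinj : Function.Injective SX := by
    refine (injective_iff_map_eq_zero SX).2 fun x hx => ?_
    have h : P (x : E) = ⟨x, hx⟩ := hP ⟨x, hx⟩
    have h' : P (x : E) = 0 := x.2
    rw [h'] at h
    exact Subtype.ext (congrArg Subtype.val h).symm
  have hran : Set.range SX = (LinearMap.range (S : E →ₗ[ℂ] E) : Set E) := by
    ext y
    constructor
    · rintro ⟨x, rfl⟩
      exact ⟨x, rfl⟩
    · rintro ⟨x, rfl⟩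
      refine ⟨⟨x - P x, hdec x⟩, ?_⟩
      change S (x - P x) = S x
      rw [map_sub, hSP, sub_zero]
  obtain ⟨K, hK⟩ := SX.antilipschitz_of_injective_of_isClosed_range hinj (by rw [hran]; exact h2)
  have hlim : Tendsto (fun n => f n - (P (f n) : E)) atTop (𝓝 0) := by
    have hb : ∀ n, ‖f n - (P (f n) : E)‖ ≤ K * ‖S (f n)‖ := fun n => by
      have := hK.le_mul_norm_sub (⟨f n - P (f n), hdec _⟩ : X) 0
      have h' : SX (⟨f n - P (f n), hdec _⟩ : X) = S (f n) := by
        change S (f n - P (f n)) = S (f n)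
        rw [map_sub, hSP, sub_zero]
      rw [h', map_zero, add_zero, add_zero, norm_neg, norm_neg] at this
      exact this
    refine squeeze_zero_norm hb ?_
    simpa using (hSf.norm.const_mul (K : ℝ))
  have hbdd : ∀ n, P (f n) ∈ Metric.closedBall (0 : LinearMap.ker (S : E →ₗ[ℂ] E)) (‖P‖ * C) :=
    fun n => by
      rw [mem_closedBall_zero_iff]
      exact (P.le_opNorm _).trans (mul_le_mul_of_nonneg_left (hf n) (norm_nonneg _))
  have : ProperSpace (LinearMap.ker (S : E →ₗ[ℂ] E)) := FiniteDimensional.proper ℂ _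
  obtain ⟨k, -, φ, hφ, hk⟩ := (isCompact_closedBall _ _).tendsto_subseq hbdd
  refine ⟨k, φ, hφ, ?_⟩
  have h := (hlim.comp hφ.tendsto_atTop).add ((continuous_subtype_val.tendsto k).comp hk)
  simpa [Function.comp_def] using h

end FredholmIndexZero

/-! ### The space of bounded uniformly continuous functions -/

namespace BUC

instance : CoeFun BUC fun _ => ℝ → ℂ := ⟨fun f => (f : ℝ →ᵇ ℂ)⟩

theorem ext {f g : BUC} (h : ∀ x, f x = g x) : f = g :=
  Subtype.ext (BoundedContinuousFunction.ext h)

theorem uniformContinuous (f : BUC) : UniformContinuous f := f.2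

theorem continuous (f : BUC) : Continuous f := f.2.continuous

@[simp] theorem add_apply (f g : BUC) (x : ℝ) : (f + g) x = f x + g x := rfl
@[simp] theorem sub_apply (f g : BUC) (x : ℝ) : (f - g) x = f x - g x := rfl
@[simp] theorem neg_apply (f : BUC) (x : ℝ) : (-f) x = -f x := rfl
@[simp] theorem smul_apply (c : ℂ) (f : BUC) (x : ℝ) : (c • f) x = c * f x := rfl
@[simp] theorem zero_apply (x : ℝ) : (0 : BUC) x = 0 := rfl

theorem norm_apply_le (f : BUC) (x : ℝ) : ‖f x‖ ≤ ‖f‖ :=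
  BoundedContinuousFunction.norm_coe_le_norm (f : ℝ →ᵇ ℂ) x

theorem norm_le {f : BUC} {C : ℝ} (hC : 0 ≤ C) : ‖f‖ ≤ C ↔ ∀ x, ‖f x‖ ≤ C :=
  BoundedContinuousFunction.norm_le (f := (f : ℝ →ᵇ ℂ)) hC

/-- A bounded uniformly continuous function as an element of `BUC`. -/
def mk (f : ℝ → ℂ) (hf : UniformContinuous f) (hb : ∃ C, ∀ x, ‖f x‖ ≤ C) : BUC :=
  ⟨BoundedContinuousFunction.ofNormedAddCommGroup f hf.continuous hb.choose hb.choose_spec, hf⟩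

@[simp] theorem mk_apply (f : ℝ → ℂ) (hf : UniformContinuous f) (hb : ∃ C, ∀ x, ‖f x‖ ≤ C)
    (x : ℝ) : mk f hf hb x = f x := rfl

instance : CompleteSpace BUC := by
  have : IsClosed (BUC : Set (ℝ →ᵇ ℂ)) := by
    refine isClosed_of_closure_subset fun f hf => ?_
    obtain ⟨u, hu, hlim⟩ := mem_closure_iff_seq_limit.1 hf
    exact (BoundedContinuousFunction.tendsto_iff_tendstoUniformly.1 hlim).uniformContinuous
      (Frequently.of_forall hu)
  exact this.completeSpace_coe

theorem uniformContinuous_of_hasDerivAt {f g : ℝ → ℂ} (h : ∀ x, HasDerivAt f (g x) x)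
    {C : ℝ} (hg : ∀ x, ‖g x‖ ≤ C) : UniformContinuous f := by
  refine (lipschitzWith_of_nnnorm_deriv_le (C := C.toNNReal)
    (fun x => (h x).differentiableAt) fun x => ?_).uniformContinuous
  rw [(h x).deriv, ← norm_toNNReal]
  exact Real.toNNReal_le_toNNReal (hg x)

theorem norm_sub_le_of_hasDerivAt {f g : ℝ → ℂ} (h : ∀ x, HasDerivAt f (g x) x)
    {C : ℝ} (hg : ∀ x, ‖g x‖ ≤ C) (x y : ℝ) : ‖f x - f y‖ ≤ C * |x - y| :=
  Convex.norm_image_sub_le_of_norm_hasDerivWithin_le (s := Set.univ)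
    (fun x _ => (h x).hasDerivWithinAt) (fun x _ => hg x) convex_univ (Set.mem_univ y)
    (Set.mem_univ x)

/-- The bounded operator with a given pointwise description. -/
def mkOp (F : BUC → BUC) (h₁ : ∀ f g x, F (f + g) x = F f x + F g x)
    (h₂ : ∀ (c : ℂ) f x, F (c • f) x = c * F f x) (C : ℝ) (hC : 0 ≤ C)
    (h₃ : ∀ f x, ‖F f x‖ ≤ C * ‖f‖) : BUC →L[ℂ] BUC :=
  LinearMap.mkContinuous
    { toFun := F
      map_add' := fun f g => ext (h₁ f g)
      map_smul' := fun c f => ext (h₂ c f) } C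
    fun f => (norm_le (by positivity)).2 (h₃ f)

theorem uniformContinuous_mul (c f : BUC) : UniformContinuous fun x => c x * f x := by
  refine Metric.uniformContinuous_iff.2 fun ε hε => ?_
  set M := ‖c‖ + ‖f‖ + 1 with hM
  have hM0 : 0 < M := by positivity
  obtain ⟨δ₁, h₁, hc⟩ := Metric.uniformContinuous_iff.1 (uniformContinuous c) (ε / (2 * M))
    (by positivity)
  obtain ⟨δ₂, h₂, hf⟩ := Metric.uniformContinuous_iff.1 (uniformContinuous f) (ε / (2 * M))
    (by positivity)
  refine ⟨min δ₁ δ₂, lt_min h₁ h₂, fun {x y} hxy => ?_⟩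
  have h3 := hc (hxy.trans_le (min_le_left _ _))
  have h4 := hf (hxy.trans_le (min_le_right _ _))
  rw [dist_eq_norm] at h3 h4 ⊢
  have hcM : ‖c x‖ ≤ M := (norm_apply_le c x).trans (by linarith [norm_nonneg f])
  have hfM : ‖f y‖ ≤ M := (norm_apply_le f y).trans (by linarith [norm_nonneg c])
  calc ‖c x * f x - c y * f y‖ = ‖c x * (f x - f y) + (c x - c y) * f y‖ := by ring_nf
    _ ≤ ‖c x‖ * ‖f x - f y‖ + ‖c x - c y‖ * ‖f y‖ := by
        rw [← norm_mul, ← norm_mul]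
        exact norm_add_le _ _
    _ ≤ M * ‖f x - f y‖ + ‖c x - c y‖ * M := by gcongr
    _ < M * (ε / (2 * M)) + (ε / (2 * M)) * M := by gcongr
    _ = ε := by field_simp; ring

/-- Multiplication by a function. -/
def mulOp (c : BUC) : BUC →L[ℂ] BUC :=
  mkOp (fun f => ⟨(c : ℝ →ᵇ ℂ) * f, uniformContinuous_mul c f⟩)
    (fun f g x => mul_add (c x) (f x) (g x)) (fun a f x => mul_left_comm (c x) a (f x))
    ‖c‖ (norm_nonneg _) fun f x => by
      change ‖c x * f x‖ ≤ _
      rw [norm_mul]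
      exact mul_le_mul (norm_apply_le c x) (norm_apply_le f x) (norm_nonneg _) (norm_nonneg _)

@[simp] theorem mulOp_apply (c f : BUC) (x : ℝ) : mulOp c f x = c x * f x := rfl

/-- Reflection at the origin. -/
def reflect : BUC →L[ℂ] BUC :=
  mkOp (fun f => mk (fun x => f (-x)) ((uniformContinuous f).comp uniformContinuous_neg)
      ⟨‖f‖, fun x => norm_apply_le f (-x)⟩)
    (fun _ _ _ => rfl) (fun _ _ _ => rfl) 1 zero_le_one fun f x => by
      rw [one_mul]
      exact norm_apply_le f (-x)

/-! ### Solution operators of first order equations -/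

theorem hasDerivAt_exp_neg_mul (μ : ℂ) (x : ℝ) :
    HasDerivAt (fun x : ℝ => Complex.exp (-(μ * x))) (Complex.exp (-(μ * x)) * -μ) x := by
  have h : HasDerivAt (fun x : ℝ => -(μ * (x : ℂ))) (-(μ * (1 : ℝ))) x :=
    ((hasDerivAt_id x).ofReal_comp.const_mul μ).neg
  rw [Complex.ofReal_one, mul_one] at h
  exact h.cexp


section FirstOrder

variable {μ : ℂ} (hμ : 0 < μ.re)

include hμ

theorem integrableOn_exp_mul (f : BUC) (x : ℝ) :
    MeasureTheory.IntegrableOn (fun y : ℝ => Complex.exp (μ * y) * f y) (Set.Iic x) := by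
  have h := integrableOn_exp_mul_complex_Iic hμ x
  exact h.mul_bdd (c := ‖f‖) (BUC.continuous f).aestronglyMeasurable
    (Eventually.of_forall fun y => norm_apply_le f y)

/-- The kernel `exp (-μ (x - y))` on `y ≤ x` has total absolute mass `1 / Re μ`. -/
theorem norm_exp_neg_mul_integral_le (f : BUC) (x : ℝ) :
    ‖Complex.exp (-(μ * x)) * ∫ y in Set.Iic x, Complex.exp (μ * y) * f y‖ ≤ μ.re⁻¹ * ‖f‖ := by
  have h1 : ‖∫ y in Set.Iic x, Complex.exp (μ * y) * f y‖
      ≤ ∫ y in Set.Iic x, Real.exp (μ.re * y) * ‖f‖ := by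
    refine MeasureTheory.norm_integral_le_of_norm_le
      ((integrableOn_exp_mul_Iic hμ x).mul_const _) (Eventually.of_forall fun y => ?_)
    rw [norm_mul, Complex.norm_exp]
    rw [Complex.re_mul_ofReal]
    exact mul_le_mul_of_nonneg_left (norm_apply_le f y) (Real.exp_pos _).le
  rw [MeasureTheory.integral_mul_const, integral_exp_mul_Iic hμ] at h1
  rw [norm_mul, Complex.norm_exp]
  have h2 : (-(μ * x)).re = -(μ.re * x) := by simp
  rw [h2]
  calc Real.exp (-(μ.re * x)) * _ ≤ Real.exp (-(μ.re * x)) * (Real.exp (μ.re * x) / μ.re * ‖f‖) :=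
        mul_le_mul_of_nonneg_left h1 (Real.exp_pos _).le
    _ = (Real.exp (-(μ.re * x)) * Real.exp (μ.re * x)) * (μ.re⁻¹ * ‖f‖) := by ring
    _ = μ.re⁻¹ * ‖f‖ := by
        rw [← Real.exp_add, neg_add_cancel, Real.exp_zero, one_mul]

theorem hasDerivAt_exp_neg_mul_integral (f : BUC) (x : ℝ) :
    HasDerivAt (fun x : ℝ => Complex.exp (-(μ * x)) * ∫ y in Set.Iic x, Complex.exp (μ * y) * f y)
      (f x - μ * (Complex.exp (-(μ * x)) * ∫ y in Set.Iic x, Complex.exp (μ * y) * f y)) x := by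
  set g : ℝ → ℂ := fun y => Complex.exp (μ * y) * f y with hg
  have hgc : Continuous g := by
    have := BUC.continuous f
    fun_prop
  have h1 : HasDerivAt (fun x : ℝ => ∫ y in Set.Iic x, g y) (g x) x := by
    have h : (fun x : ℝ => ∫ y in Set.Iic x, g y)
        = fun x => (∫ y in Set.Iic 0, g y) + ∫ y in (0 : ℝ)..x, g y := by
      funext x
      rw [← intervalIntegral.integral_Iic_sub_Iic (integrableOn_exp_mul hμ f 0)
        (integrableOn_exp_mul hμ f x)]
      ring
    rw [h]
    exact (hgc.integral_hasStrictDerivAt 0 x).hasDerivAt.const_add _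
  have h2 := hasDerivAt_exp_neg_mul μ x
  refine (h2.mul h1).congr_deriv ?_
  have h3 : Complex.exp (-(μ * x)) * g x = f x := by
    rw [hg]
    change Complex.exp (-(μ * x)) * (Complex.exp (μ * x) * f x) = f x
    rw [← mul_assoc, ← Complex.exp_add]
    simp
  rw [h3]
  ring

/-- The inverse of `d/dx + μ` for `Re μ > 0`. -/
def forwardOp : BUC →L[ℂ] BUC :=
  mkOp (fun f => mk
      (fun x : ℝ => Complex.exp (-(μ * x)) * ∫ y in Set.Iic x, Complex.exp (μ * y) * f y)
      (uniformContinuous_of_hasDerivAt (hasDerivAt_exp_neg_mul_integral hμ f)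
        (C := ‖f‖ + ‖μ‖ * (μ.re⁻¹ * ‖f‖)) fun x => (norm_sub_le _ _).trans
          (add_le_add (norm_apply_le f x) (by
            rw [norm_mul]
            exact mul_le_mul_of_nonneg_left (norm_exp_neg_mul_integral_le hμ f x)
              (norm_nonneg _))))
      ⟨_, norm_exp_neg_mul_integral_le hμ f⟩)
    (fun f g x => by
      simp only [mk_apply, add_apply, mul_add]
      rw [MeasureTheory.integral_add (integrableOn_exp_mul hμ f x) (integrableOn_exp_mul hμ g x),
        mul_add])
    (fun c f x => by
      simp only [mk_apply, smul_apply, mul_left_comm _ c]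
      rw [MeasureTheory.integral_const_mul, mul_left_comm])
    μ.re⁻¹ (inv_nonneg.2 hμ.le) (norm_exp_neg_mul_integral_le hμ)

theorem forwardOp_hasDerivAt (f : BUC) (x : ℝ) :
    HasDerivAt (forwardOp hμ f) (f x - μ * forwardOp hμ f x) x :=
  hasDerivAt_exp_neg_mul_integral hμ f x

/-- The inverse of `d/dx - μ` for `Re μ > 0`. -/
def backwardOp : BUC →L[ℂ] BUC := -(reflect ∘L forwardOp hμ ∘L reflect)

theorem backwardOp_hasDerivAt (f : BUC) (x : ℝ) :
    HasDerivAt (backwardOp hμ f) (f x + μ * backwardOp hμ f x) x := by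
  have h := ((forwardOp_hasDerivAt hμ (reflect f) (-x)).scomp x (hasDerivAt_neg x)).neg
  refine h.congr_deriv ?_
  change -((-1 : ℝ) • (f (- -x) - μ * forwardOp hμ (reflect f) (-x)))
    = f x + μ * -(forwardOp hμ (reflect f) (-x))
  rw [neg_neg x]
  simp
  ring

/-- The inverse of `d²/dx² - μ²` for `Re μ > 0`. -/
def resolventOp : BUC →L[ℂ] BUC := backwardOp hμ ∘L forwardOp hμ

/-- The first derivative of `resolventOp`. -/
def derivResolventOp : BUC →L[ℂ] BUC := forwardOp hμ + μ • resolventOp hμ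

theorem resolventOp_hasDerivAt (f : BUC) (x : ℝ) :
    HasDerivAt (resolventOp hμ f) (derivResolventOp hμ f x) x :=
  backwardOp_hasDerivAt hμ (forwardOp hμ f) x

theorem derivResolventOp_hasDerivAt (f : BUC) (x : ℝ) :
    HasDerivAt (derivResolventOp hμ f) ((f + μ ^ 2 • resolventOp hμ f) x) x := by
  refine ((forwardOp_hasDerivAt hμ f x).add
    ((resolventOp_hasDerivAt hμ f x).const_mul μ)).congr_deriv ?_
  change _ - _ + μ * (forwardOp hμ f x + μ * resolventOp hμ f x)
    = f x + μ ^ 2 * resolventOp hμ f x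
  ring

end FirstOrder

/-! ### The second derivative -/

/-- `w` is twice continuously differentiable with second derivative `g`. -/
def IsSecondDeriv (w g : BUC) : Prop := ContDiff ℝ 2 w ∧ ∀ x, iteratedDeriv 2 w x = g x

/-- An explicit first derivative reduces sums, products and uniqueness to `HasDerivAt`; continuity
of `g` gives back the `C²` condition. -/
theorem isSecondDeriv_iff {w g : BUC} :
    IsSecondDeriv w g ↔ ∃ d : ℝ → ℂ, (∀ x, HasDerivAt w (d x) x) ∧ ∀ x, HasDerivAt d (g x) x := by
  constructor
  · rintro ⟨h1, h2⟩
    have h3 : ContDiff ℝ 1 (deriv w) := by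
      have h : ContDiff ℝ (1 + 1) w := by simpa [one_add_one_eq_two] using h1
      exact (contDiff_succ_iff_deriv.1 h).2.2
    refine ⟨deriv w, fun x => (h1.differentiable (by norm_num) x).hasDerivAt, fun x => ?_⟩
    rw [← h2 x, iteratedDeriv_succ, iteratedDeriv_one]
    exact (h3.differentiable (by norm_num) x).hasDerivAt
  · rintro ⟨d, h1, h2⟩
    have h3 : deriv w = d := funext fun x => (h1 x).deriv
    have h4 : deriv d = g := funext fun x => (h2 x).deriv
    refine ⟨?_, fun x => ?_⟩
    · have h : ContDiff ℝ (1 + 1) w := by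
        refine contDiff_succ_iff_deriv.2 ⟨fun x => (h1 x).differentiableAt, by simp, ?_⟩
        rw [h3]
        refine contDiff_one_iff_deriv.2 ⟨fun x => (h2 x).differentiableAt, ?_⟩
        rw [h4]
        exact BUC.continuous g
      simpa [one_add_one_eq_two] using h
    · rw [iteratedDeriv_succ, iteratedDeriv_one, h3, h4]

theorem IsSecondDeriv.add {w g w' g' : BUC} (h : IsSecondDeriv w g) (h' : IsSecondDeriv w' g') :
    IsSecondDeriv (w + w') (g + g') := by
  obtain ⟨d, h1, h2⟩ := isSecondDeriv_iff.1 h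
  obtain ⟨d', h1', h2'⟩ := isSecondDeriv_iff.1 h'
  exact isSecondDeriv_iff.2
    ⟨fun x => d x + d' x, fun x => (h1 x).add (h1' x), fun x => (h2 x).add (h2' x)⟩

theorem IsSecondDeriv.smul (c : ℂ) {w g : BUC} (h : IsSecondDeriv w g) :
    IsSecondDeriv (c • w) (c • g) := by
  obtain ⟨d, h1, h2⟩ := isSecondDeriv_iff.1 h
  exact isSecondDeriv_iff.2
    ⟨fun x => c * d x, fun x => (h1 x).const_mul c, fun x => (h2 x).const_mul c⟩

theorem IsSecondDeriv.unique {w g g' : BUC} (h : IsSecondDeriv w g) (h' : IsSecondDeriv w g') :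
    g = g' :=
  ext fun x => (h.2 x).symm.trans (h'.2 x)

theorem isSecondDeriv_resolventOp {μ : ℂ} (hμ : 0 < μ.re) (f : BUC) :
    IsSecondDeriv (resolventOp hμ f) (f + μ ^ 2 • resolventOp hμ f) :=
  isSecondDeriv_iff.2
    ⟨derivResolventOp hμ f, resolventOp_hasDerivAt hμ f, derivResolventOp_hasDerivAt hμ f⟩

/-- A bounded function with bounded second derivative has a bounded first derivative. -/
theorem norm_deriv_le_of_isSecondDeriv {w g : BUC} {d : ℝ → ℂ} (h1 : ∀ x, HasDerivAt w (d x) x)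
    (h2 : ∀ x, HasDerivAt d (g x) x) (x : ℝ) : ‖d x‖ ≤ 2 * ‖w‖ + ‖g‖ := by
  have h3 : ∀ t, ‖d t - d x‖ ≤ ‖g‖ * |t - x| := fun t =>
    norm_sub_le_of_hasDerivAt h2 (fun t => norm_apply_le g t) t x
  -- On `[x, x + 1]`, `w` is compared with the line of slope `d x`; the difference has derivative `d
  -- t - d x`, which `h3` bounds by `‖g‖`.
  have h4 : ‖(w (x + 1) - (x + 1 : ℝ) • d x) - (w x - x • d x)‖ ≤ ‖g‖ * ‖x + 1 - x‖ := by
    refine Convex.norm_image_sub_le_of_norm_hasDerivWithin_le (s := Set.Icc x (x + 1))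
      (f := fun t : ℝ => w t - t • d x) (f' := fun t => d t - d x) (fun t ht => ?_) (fun t ht => ?_)
      (convex_Icc _ _) (by simp) (by simp)
    · have h := (h1 t).sub ((hasDerivAt_id t).smul_const (d x))
      rw [one_smul] at h
      exact h.hasDerivWithinAt
    · refine (h3 t).trans ?_
      have : |t - x| ≤ 1 := by
        rw [abs_le]
        constructor <;> linarith [ht.1, ht.2]
      exact (mul_le_mul_of_nonneg_left this (norm_nonneg g)).trans_eq (mul_one _)
  have h5 : (w (x + 1) - (x + 1 : ℝ) • d x) - (w x - x • d x) = w (x + 1) - w x - d x := by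
    rw [add_smul, one_smul]
    ring
  rw [h5, add_sub_cancel_left, norm_one, mul_one] at h4
  have h6 : d x = (w (x + 1) - w x) - (w (x + 1) - w x - d x) := by ring
  rw [h6]
  refine (norm_sub_le _ _).trans (add_le_add ?_ h4)
  refine (norm_sub_le _ _).trans ?_
  rw [two_mul]
  exact add_le_add (norm_apply_le _ _) (norm_apply_le _ _)

/-- All solutions are multiples of `exp (μ x)`, and a nonzero one is unbounded at `+∞`. -/
theorem eq_zero_of_hasDerivAt_mul {μ : ℂ} (hμ : 0 < μ.re) {z : ℝ → ℂ}
    (hz : ∀ x, HasDerivAt z (μ * z x) x) {C : ℝ} (hC : ∀ x, ‖z x‖ ≤ C) (x : ℝ) : z x = 0 := by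
  have hE := hasDerivAt_exp_neg_mul μ
  have hconst : ∀ t : ℝ, Complex.exp (-(μ * t)) * z t = Complex.exp (-(μ * x)) * z x := fun t =>
    is_const_of_deriv_eq_zero (f := fun t : ℝ => Complex.exp (-(μ * t)) * z t)
      (fun t => ((hE t).mul (hz t)).differentiableAt)
      (fun t => (((hE t).mul (hz t)).congr_deriv (by ring)).deriv) t x
  have hlim : Tendsto (fun t : ℝ => Complex.exp (-(μ * t)) * z t) atTop (𝓝 0) := by
    refine squeeze_zero_norm (a := fun t => Real.exp (-(μ.re * t)) * C) (fun t => ?_) ?_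
    · rw [norm_mul, Complex.norm_exp]
      have h2 : (-(μ * t)).re = -(μ.re * t) := by simp
      rw [h2]
      exact mul_le_mul_of_nonneg_left (hC t) (Real.exp_pos _).le
    · have h := (Real.tendsto_exp_neg_atTop_nhds_zero.comp
        (tendsto_id.const_mul_atTop hμ)).mul_const C
      simpa using h
  have h0 : Complex.exp (-(μ * x)) * z x = 0 := by
    refine tendsto_nhds_unique ?_ hlim
    simp only [hconst]
    exact tendsto_const_nhds
  exact (mul_eq_zero.1 h0).resolve_left (Complex.exp_ne_zero _)

/-- Factor `D² - μ² = (D - μ)(D + μ)`: both `w' + μ w` and the reflection of `w' - μ w` solve `z' =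
μ z` and are bounded, hence vanish, and their difference gives `2 μ w = 0`. -/
theorem eq_zero_of_isSecondDeriv {μ : ℂ} (hμ : 0 < μ.re) {w : BUC}
    (h : IsSecondDeriv w (μ ^ 2 • w)) : w = 0 := by
  obtain ⟨d, h1, h2⟩ := isSecondDeriv_iff.1 h
  have hd := norm_deriv_le_of_isSecondDeriv h1 h2
  set M := 2 * ‖w‖ + ‖μ ^ 2 • w‖
  have hμw : ∀ x, ‖μ * w x‖ ≤ ‖μ‖ * ‖w‖ := fun x => by
    rw [norm_mul]
    exact mul_le_mul_of_nonneg_left (norm_apply_le w x) (norm_nonneg _)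
  have hz : ∀ x, d x + μ * w x = 0 := by
    refine eq_zero_of_hasDerivAt_mul hμ (z := fun x => d x + μ * w x) (C := M + ‖μ‖ * ‖w‖)
      (fun x => ((h2 x).add ((h1 x).const_mul μ)).congr_deriv ?_)
      fun x => (norm_add_le _ _).trans (add_le_add (hd x) (hμw x))
    rw [smul_apply]
    ring
  have hy : ∀ x, d (-x) - μ * w (-x) = 0 := by
    refine eq_zero_of_hasDerivAt_mul hμ (z := fun x => d (-x) - μ * w (-x)) (C := M + ‖μ‖ * ‖w‖)
      (fun x => ?_) fun x => (norm_sub_le _ _).trans (add_le_add (hd _) (hμw _))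
    have h3 := ((h2 (-x)).sub ((h1 (-x)).const_mul μ)).scomp x (hasDerivAt_neg x)
    refine h3.congr_deriv ?_
    rw [smul_apply]
    simp
    ring
  have hμ0 : μ ≠ 0 := fun h => by simp [h] at hμ
  refine ext fun x => ?_
  have h3 := hz x
  have h4 := hy (-x)
  rw [neg_neg] at h4
  have h5 : 2 * μ * w x = 0 := by linear_combination h3 - h4
  simpa [hμ0] using h5

/-- Having `w` on both sides turns membership in the domain of `D²` into a fixed-point equation,
valid for every admissible `μ`. -/
theorem isSecondDeriv_iff_eq_resolventOp {μ : ℂ} (hμ : 0 < μ.re) {w g : BUC} :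
    IsSecondDeriv w g ↔ w = resolventOp hμ (g - μ ^ 2 • w) := by
  constructor
  · intro h
    have h1 := h.add ((isSecondDeriv_resolventOp hμ (g - μ ^ 2 • w)).smul (-1))
    have h2 : w + (-1 : ℂ) • resolventOp hμ (g - μ ^ 2 • w) = 0 := by
      refine eq_zero_of_isSecondDeriv hμ ?_
      convert h1 using 1
      module
    refine sub_eq_zero.1 (Eq.trans ?_ h2)
    module
  · intro h
    have h1 := isSecondDeriv_resolventOp hμ (g - μ ^ 2 • w)
    rw [← h, sub_add_cancel] at h1
    exact h1

end BUC

/-! ### Finite rank approximation of decaying multiplication operators -/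

theorem finiteRankClosure.sum {E E' ι : Type*} [NormedAddCommGroup E] [NormedSpace ℂ E]
    [NormedAddCommGroup E'] [NormedSpace ℂ E'] {K : ι → E →L[ℂ] E'} {s : Finset ι}
    (hK : ∀ i ∈ s, K i ∈ finiteRankClosure E E') : ∑ i ∈ s, K i ∈ finiteRankClosure E E' := by
  refine Finset.sum_induction _ _ (fun _ _ h h' => finiteRankClosure.add h h') (subset_closure ?_) hK
  have h : LinearMap.range ((0 : E →L[ℂ] E') : E →ₗ[ℂ] E') = ⊥ := LinearMap.range_zero
  change FiniteDimensional ℂ _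
  rw [h]
  infer_instance

/-- A continuous partition of unity on a compact interval, subordinate to small balls. -/
theorem exists_partition_of_unity_Icc (M : ℝ) {δ : ℝ} (hδ : 0 < δ) :
    ∃ (s : Finset ℝ) (φ : ℝ → ℝ → ℝ), (∀ p, Continuous (φ p)) ∧ (∀ p x, 0 ≤ φ p x) ∧
      (∀ x, ∑ p ∈ s, φ p x ≤ 1) ∧ (∀ x, |x| ≤ M → ∑ p ∈ s, φ p x = 1) ∧
      ∀ p x, φ p x ≠ 0 → |x - p| ≤ 2 * δ := by
  obtain ⟨s, -, hs⟩ := (isCompact_Icc (a := -M) (b := M)).elim_nhds_subcover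
    (fun x => Metric.ball x δ) fun x _ => Metric.ball_mem_nhds x hδ
  -- Tents of radius `2δ` around the centres. Where a centre lies within `δ` their sum is at least
  -- `δ`, so dividing by the maximum of the sum and `δ` normalizes it there and never divides by
  -- zero elsewhere.
  let ψ : ℝ → ℝ → ℝ := fun p x => max 0 (2 * δ - |x - p|)
  have hψ0 : ∀ p x, 0 ≤ ψ p x := fun p x => le_max_left _ _
  have hψc : ∀ p, Continuous (ψ p) := fun p => by fun_prop
  have hden : ∀ x, 0 < max (∑ p ∈ s, ψ p x) δ := fun x => lt_max_of_lt_right hδ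
  have hsum : ∀ x, ∑ p ∈ s, ψ p x / max (∑ p ∈ s, ψ p x) δ
      = (∑ p ∈ s, ψ p x) / max (∑ p ∈ s, ψ p x) δ := fun x => (Finset.sum_div _ _ _).symm
  refine ⟨s, fun p x => ψ p x / max (∑ p ∈ s, ψ p x) δ, fun p => ?_, fun p x => ?_, fun x => ?_,
    fun x hx => ?_, fun p x hx => ?_⟩
  · exact (hψc p).div ((continuous_finsetSum _ fun p _ => hψc p).max continuous_const)
      fun x => (hden x).ne'
  · exact div_nonneg (hψ0 p x) (hden x).le
  · rw [hsum, div_le_one (hden x)]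
    exact le_max_left _ _
  · obtain ⟨p, hp, hxp⟩ : ∃ p ∈ s, |x - p| < δ := by
      have := hs (abs_le.1 hx)
      simpa [Real.dist_eq] using this
    have h1 : δ ≤ ψ p x := le_max_of_le_right (by linarith)
    have h2 : δ ≤ ∑ p ∈ s, ψ p x :=
      h1.trans (Finset.single_le_sum (f := fun p => ψ p x) (fun p _ => hψ0 p x) hp)
    rw [hsum, max_eq_left h2, div_self (hδ.trans_le h2).ne']
  · by_contra! h
    exact hx (by simp [ψ, max_eq_left (by linarith : 2 * δ - |x - p| ≤ 0)])

namespace BUC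

/-- A continuous function vanishing at infinity as an element of `BUC`. -/
def ofDecay (c : ℝ → ℂ) (hc : Continuous c) (h : Tendsto c (cocompact ℝ) (𝓝 0)) : BUC :=
  mk c (hc.uniformContinuous_of_tendsto_cocompact h)
    ⟨_, (ZeroAtInftyContinuousMap.toBCF (⟨⟨c, hc⟩, h⟩ : ZeroAtInftyContinuousMap ℝ ℂ)).norm_coe_le_norm⟩

@[simp] theorem ofDecay_apply (c : ℝ → ℂ) (hc : Continuous c) (h : Tendsto c (cocompact ℝ) (𝓝 0))
    (x : ℝ) : ofDecay c hc h x = c x := rfl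

/-- Evaluation at a point. -/
def evalOp (p : ℝ) : BUC →L[ℂ] ℂ :=
  LinearMap.mkContinuous
    { toFun := fun f => f p
      map_add' := fun _ _ => rfl
      map_smul' := fun _ _ => rfl } 1 fun f => by
    rw [one_mul]
    exact norm_apply_le f p

theorem sum_apply {ι : Type*} (s : Finset ι) (f : ι → BUC) (x : ℝ) :
    (∑ i ∈ s, f i : BUC) x = ∑ i ∈ s, f i x :=
  map_sum (evalOp x) f s

/-- Multiplication by a decaying function after a smoothing operator is a limit of operators of
finite rank. -/
theorem mulOp_comp_mem_finiteRankClosure {c : BUC} (hc : Tendsto c (cocompact ℝ) (𝓝 0))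
    {W : BUC →L[ℂ] BUC} {C : ℝ} (hC : 0 ≤ C)
    (hW : ∀ f x y, ‖W f x - W f y‖ ≤ C * ‖f‖ * |x - y|) :
    mulOp c ∘L W ∈ finiteRankClosure BUC BUC := by
  have key : ∀ ε > 0, ∃ F ∈ finiteRankClosure BUC BUC,
      ‖mulOp c ∘L W - F‖ ≤ ε * (2 * ‖c‖ * C + 2 * ‖W‖) := by
    intro ε hε
    obtain ⟨R, hR⟩ : ∃ R, ∀ x : ℝ, R ≤ |x| → ‖c x‖ ≤ ε := by
      have h1 : ∀ᶠ x in cocompact ℝ, ‖c x‖ ≤ ε := by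
        have h0 : ‖(0 : ℂ)‖ < ε := by rwa [norm_zero]
        exact hc.norm.eventually (Iic_mem_nhds h0)
      rw [← Metric.cobounded_eq_cocompact, ← comap_norm_atTop, eventually_comap] at h1
      obtain ⟨R, hR⟩ := eventually_atTop.1 h1
      exact ⟨R, fun x hx => hR _ hx x rfl⟩
    -- `W f` is replaced by an interpolation of its values at finitely many points, which has finite
    -- rank. For `|x| ≤ R` the Lipschitz bound controls the error, for `|x| ≥ R` the smallness of
    -- `c` does.
    obtain ⟨s, φ, hφc, hφ0, hφle, hφ1, hφs⟩ := exists_partition_of_unity_Icc R hε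
    have hφb : ∀ p ∈ s, ∀ x, φ p x ≤ 1 := fun p hp x =>
      (Finset.single_le_sum (f := fun p => φ p x) (fun p _ => hφ0 p x) hp).trans (hφle x)
    have hdec : ∀ p ∈ s, Tendsto (fun x => c x * (φ p x : ℂ)) (cocompact ℝ) (𝓝 0) := fun p hp => by
      refine squeeze_zero_norm (fun x => ?_) (by simpa only [norm_zero] using hc.norm)
      rw [norm_mul, Complex.norm_real, Real.norm_of_nonneg (hφ0 p x)]
      exact mul_le_of_le_one_right (norm_nonneg _) (hφb p hp x)
    let cφ : s → BUC := fun p => ofDecay (fun x => c x * (φ p x : ℂ))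
      ((BUC.continuous c).mul (Complex.continuous_ofReal.comp (hφc p))) (hdec p p.2)
    refine ⟨∑ p ∈ s.attach, ((evalOp (p : ℝ) ∘L W).smulRight (cφ p)),
      finiteRankClosure.sum fun p _ => subset_closure ?_, ?_⟩
    · refine Submodule.finiteDimensional_of_le (S₂ := Submodule.span ℂ {cφ p}) ?_
      rintro _ ⟨f, rfl⟩
      exact Submodule.smul_mem _ _ (Submodule.mem_span_singleton_self _)
    · refine ContinuousLinearMap.opNorm_le_bound _ (by positivity) fun f => ?_
      refine (norm_le (by positivity)).2 fun x => ?_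
      set g := W f with hg
      have hval : (mulOp c ∘L W - ∑ p ∈ s.attach, ((evalOp (p : ℝ) ∘L W).smulRight (cφ p))) f x
          = c x * (g x - ∑ p ∈ s, (φ p x : ℂ) * g p) := by
        rw [_root_.sub_apply, _root_.sum_apply, sub_apply, sum_apply]
        rw [mul_sub, Finset.mul_sum, ← Finset.sum_attach s]
        congr 1
        refine Finset.sum_congr rfl fun p _ => ?_
        change g p * (c x * (φ p x : ℂ)) = _
        ring
      rw [hval, norm_mul]
      have hgn : ‖g‖ ≤ ‖W‖ * ‖f‖ := W.le_opNorm f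
      have hsumle : ∀ B : ℝ, 0 ≤ B → (∑ p ∈ s, φ p x * B) ≤ B := fun B hB => by
        rw [← Finset.sum_mul]
        exact mul_le_of_le_one_left hB (hφle x)
      rcases le_total |x| R with hx | hx
      · have h1 : g x - ∑ p ∈ s, (φ p x : ℂ) * g p = ∑ p ∈ s, (φ p x : ℂ) * (g x - g p) := by
          simp only [mul_sub, Finset.sum_sub_distrib, ← Finset.sum_mul]
          rw [← Complex.ofReal_sum, hφ1 x hx, Complex.ofReal_one, one_mul]
        have h2 : ‖∑ p ∈ s, (φ p x : ℂ) * (g x - g p)‖ ≤ C * ‖f‖ * (2 * ε) := by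
          refine (norm_sum_le _ _).trans ((Finset.sum_le_sum fun p _ => ?_).trans
            (hsumle (C * ‖f‖ * (2 * ε)) (by positivity)))
          rw [norm_mul, Complex.norm_real, Real.norm_of_nonneg (hφ0 p x)]
          by_cases h0 : φ p x = 0
          · rw [h0, zero_mul, zero_mul]
          · exact mul_le_mul_of_nonneg_left ((hW f x p).trans
              (mul_le_mul_of_nonneg_left (hφs p x h0) (by positivity))) (hφ0 p x)
        rw [h1]
        calc ‖c x‖ * ‖∑ p ∈ s, (φ p x : ℂ) * (g x - g p)‖ ≤ ‖c‖ * (C * ‖f‖ * (2 * ε)) :=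
              mul_le_mul (norm_apply_le c x) h2 (norm_nonneg _) (norm_nonneg _)
          _ ≤ ‖c‖ * (C * ‖f‖ * (2 * ε)) + ε * (2 * ‖W‖) * ‖f‖ :=
              le_add_of_nonneg_right (by positivity)
          _ = ε * (2 * ‖c‖ * C + 2 * ‖W‖) * ‖f‖ := by ring
      · have h2 : ‖g x - ∑ p ∈ s, (φ p x : ℂ) * g p‖ ≤ ‖g‖ + ‖g‖ := by
          refine (norm_sub_le _ _).trans (add_le_add (norm_apply_le g x) ?_)
          refine (norm_sum_le _ _).trans ((Finset.sum_le_sum fun p _ => ?_).trans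
            (hsumle ‖g‖ (norm_nonneg _)))
          rw [norm_mul, Complex.norm_real, Real.norm_of_nonneg (hφ0 p x)]
          exact mul_le_mul_of_nonneg_left (norm_apply_le g p) (hφ0 p x)
        calc ‖c x‖ * ‖g x - ∑ p ∈ s, (φ p x : ℂ) * g p‖
            ≤ ε * (‖W‖ * ‖f‖ + ‖W‖ * ‖f‖) :=
              mul_le_mul (hR x hx) (h2.trans (add_le_add hgn hgn)) (norm_nonneg _) hε.le
          _ ≤ ε * (‖W‖ * ‖f‖ + ‖W‖ * ‖f‖) + ε * (2 * ‖c‖ * C) * ‖f‖ :=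
              le_add_of_nonneg_right (by positivity)
          _ = ε * (2 * ‖c‖ * C + 2 * ‖W‖) * ‖f‖ := by ring
  have hcl : mulOp c ∘L W ∈ closure (finiteRankClosure BUC BUC) := by
    refine Metric.mem_closure_iff.2 fun ε hε => ?_
    set D := 2 * ‖c‖ * C + 2 * ‖W‖ with hD
    have hD0 : 0 ≤ D := by positivity
    obtain ⟨F, hF, hKF⟩ := key (ε / (D + 1)) (by positivity)
    refine ⟨F, hF, ?_⟩
    rw [dist_eq_norm]
    refine hKF.trans_lt ?_
    rw [div_mul_eq_mul_div, div_lt_iff₀ (by positivity)]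
    nlinarith
  rwa [finiteRankClosure, closure_closure] at hcl

theorem norm_resolventOp_sub_le {μ : ℂ} (hμ : 0 < μ.re) (f : BUC) (x y : ℝ) :
    ‖resolventOp hμ f x - resolventOp hμ f y‖ ≤ ‖derivResolventOp hμ‖ * ‖f‖ * |x - y| :=
  norm_sub_le_of_hasDerivAt (resolventOp_hasDerivAt hμ f)
    (fun x => (norm_apply_le _ x).trans ((derivResolventOp hμ).le_opNorm f)) x y

/-- The second derivative of the resolvent is again bounded in terms of `f`, so its first derivative
also smooths; this handles the drift term. -/
theorem norm_derivResolventOp_sub_le {μ : ℂ} (hμ : 0 < μ.re) (f : BUC) (x y : ℝ) :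
    ‖derivResolventOp hμ f x - derivResolventOp hμ f y‖
      ≤ ‖ContinuousLinearMap.id ℂ BUC + μ ^ 2 • resolventOp hμ‖ * ‖f‖ * |x - y| :=
  norm_sub_le_of_hasDerivAt (derivResolventOp_hasDerivAt hμ f)
    (fun x => (norm_apply_le _ x).trans
      ((ContinuousLinearMap.id ℂ BUC + μ ^ 2 • resolventOp hμ).le_opNorm f)) x y


/-! ### Constant coefficient systems and their decaying perturbations -/

theorem re_one_pos : 0 < (1 : ℂ).re := zero_lt_one

/-- The inverse of `d²/dx² - 1`. -/
def resOne : BUC →L[ℂ] BUC := resolventOp re_one_pos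

/-- The first derivative of `resOne`. -/
def derivResOne : BUC →L[ℂ] BUC := derivResolventOp re_one_pos

theorem resOne_hasDerivAt (f : BUC) (x : ℝ) : HasDerivAt (resOne f) (derivResOne f x) x :=
  resolventOp_hasDerivAt re_one_pos f x

theorem isSecondDeriv_iff_eq_resOne {w g : BUC} : IsSecondDeriv w g ↔ w = resOne (g - w) := by
  have h := isSecondDeriv_iff_eq_resolventOp re_one_pos (w := w) (g := g)
  rwa [one_pow, one_smul] at h

theorem isSecondDeriv_resOne (f : BUC) : IsSecondDeriv (resOne f) (f + resOne f) := by
  rw [isSecondDeriv_iff_eq_resOne, add_sub_cancel_right]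

theorem derivResOne_hasDerivAt (f : BUC) (x : ℝ) :
    HasDerivAt (derivResOne f) ((f + resOne f) x) x := by
  have h := derivResolventOp_hasDerivAt re_one_pos f x
  rwa [one_pow, one_smul] at h

/-- The scalar equation `w'' + m w = h` is uniquely solvable once `-m` has a square root in the
right half-plane. -/
theorem isSecondDeriv_iff_eq_resolventOp_of_sq {μ m : ℂ} (hμ : 0 < μ.re) (hm : μ ^ 2 = -m)
    {w h : BUC} : IsSecondDeriv w (h - m • w) ↔ w = resolventOp hμ h := by
  rw [isSecondDeriv_iff_eq_resolventOp hμ, hm]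
  have : h - m • w - -m • w = h := by module
  rw [this]

/-- `(D² + A)(D² - 1)⁻¹` for the constant matrix `A = [a, 1; b, d]`. -/
def constOp (a b d : ℂ) : PhaseSpace →L[ℂ] PhaseSpace :=
  let p₁ := ContinuousLinearMap.fst ℂ BUC BUC
  let p₂ := ContinuousLinearMap.snd ℂ BUC BUC
  (p₁ + (1 + a) • (resOne ∘L p₁) + resOne ∘L p₂).prod
    (p₂ + b • (resOne ∘L p₁) + (1 + d) • (resOne ∘L p₂))

theorem constOp_apply (a b d : ℂ) (f : PhaseSpace) :
    constOp a b d f = (f.1 + (1 + a) • resOne f.1 + resOne f.2,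
      f.2 + b • resOne f.1 + (1 + d) • resOne f.2) := rfl

/-- A square root of `-m` on the imaginary axis would make `m` the square of a real number; off the
axis a sign can be chosen. -/
theorem exists_sq_eq_of_forall_ne {m : ℂ} (hm : ∀ k : ℝ, m ≠ (k : ℂ) ^ 2) :
    ∃ μ : ℂ, 0 < μ.re ∧ μ ^ 2 = -m := by
  obtain ⟨μ, hμ⟩ := IsAlgClosed.exists_pow_nat_eq (-m) (n := 2) two_pos
  rcases lt_trichotomy μ.re 0 with h | h | h
  · exact ⟨-μ, by simpa using h, by rw [neg_sq, hμ]⟩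
  · exfalso
    refine hm μ.im ?_
    have h1 : μ = μ.im * Complex.I := by
      apply Complex.ext <;> simp [h]
    rw [← neg_neg m, ← hμ]
    nth_rw 1 [h1]
    rw [mul_pow, Complex.I_sq]
    ring
  · exact ⟨μ, h, hμ⟩

/-- Let `m`, `m'` be the eigenvalues of `A`. With `l = m - d`, the row `(l, 1)` is a left
eigenvector for `m`, so `z = v + l u` satisfies a scalar equation with constant `m`; substituting `v
= z - l u` in the first row leaves one for `u` with constant `m'`. This triangular form needs no
diagonalizability, so `m = m'` is allowed. -/
theorem constOp_bijective {a b d : ℂ}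
    (h : ∀ k : ℝ, (a - (k : ℂ) ^ 2) * (d - (k : ℂ) ^ 2) - b ≠ 0) :
    Function.Bijective (constOp a b d) := by
  obtain ⟨r, hr⟩ := IsAlgClosed.exists_pow_nat_eq ((a + d) ^ 2 - 4 * (a * d - b)) (n := 2) two_pos
  obtain ⟨m, m', hadd, hmul⟩ : ∃ m m' : ℂ, m + m' = a + d ∧ m * m' = a * d - b :=
    ⟨(a + d + r) / 2, (a + d - r) / 2, by ring, by linear_combination -hr / 4⟩
  obtain ⟨μ, hμ, hμm⟩ := exists_sq_eq_of_forall_ne (m := m) fun k hk =>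
    h k (by rw [← hk]; linear_combination -hmul + m * hadd)
  obtain ⟨μ', hμ', hμm'⟩ := exists_sq_eq_of_forall_ne (m := m') fun k hk =>
    h k (by rw [← hk]; linear_combination -hmul + m' * hadd)
  obtain rfl : m' = a + d - m := by linear_combination hadd
  set l := m - d with hl
  constructor
  · refine (injective_iff_map_eq_zero _).2 fun f hf => ?_
    rw [constOp_apply, Prod.mk_eq_zero] at hf
    obtain ⟨hf1, hf2⟩ := hf
    set u := resOne f.1 with hu
    set v := resOne f.2 with hv
    have hu2 : IsSecondDeriv u (f.1 + u) := isSecondDeriv_resOne f.1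
    have hv2 : IsSecondDeriv v (f.2 + v) := isSecondDeriv_resOne f.2
    have e1 : f.1 + u = -(a • u + v) := by
      rw [eq_neg_iff_add_eq_zero, ← hf1]
      module
    have e2 : f.2 + v = -(b • u + d • v) := by
      rw [eq_neg_iff_add_eq_zero, ← hf2]
      module
    have hz : v + l • u = 0 := by
      refine (isSecondDeriv_iff_eq_resolventOp_of_sq hμ hμm (h := 0)).1 ?_ |>.trans (map_zero _)
      have h3 := hv2.add (hu2.smul l)
      rw [e1, e2] at h3
      convert h3 using 1
      refine ext fun x => ?_
      simp only [sub_apply, zero_apply, add_apply, smul_apply, neg_apply, hl]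
      linear_combination u x * hmul
    have hvu : v = -(l • u) := by rw [eq_neg_iff_add_eq_zero, hz]
    have hu0 : u = 0 := by
      refine (isSecondDeriv_iff_eq_resolventOp_of_sq hμ' hμm' (h := 0)).1 ?_ |>.trans (map_zero _)
      rw [e1, hvu] at hu2
      convert hu2 using 1
      rw [hl]
      module
    have hv0 : v = 0 := by rw [hvu, hu0, smul_zero, neg_zero]
    refine Prod.ext ?_ ?_
    · rw [hu0, hv0] at e1
      simp only [add_zero, smul_zero, neg_zero] at e1
      exact e1
    · rw [hu0, hv0] at e2
      simp only [add_zero, smul_zero, neg_zero] at e2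
      exact e2
  · intro g
    set z := resolventOp hμ (g.2 + l • g.1) with hz
    set u := resolventOp hμ' (g.1 - z) with hu
    have hz2 := (isSecondDeriv_iff_eq_resolventOp_of_sq hμ hμm).2 hz
    have hu2 := (isSecondDeriv_iff_eq_resolventOp_of_sq hμ' hμm').2 hu
    have hv2 := hz2.add (hu2.smul (-l))
    set v := z + (-l) • u with hv
    have hRu := isSecondDeriv_iff_eq_resOne.1 hu2
    have hRv := isSecondDeriv_iff_eq_resOne.1 hv2
    -- The preimage is `(u'' - u, v'' - v)`, with the second derivatives read off from the scalar
    -- equations.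
    refine ⟨(g.1 - z - (a + d - m) • u - u,
      g.2 + l • g.1 - m • z + -l • (g.1 - z - (a + d - m) • u) - v), ?_⟩
    rw [constOp_apply]
    dsimp only
    rw [← hRu, ← hRv]
    refine Prod.ext ?_ ?_
    · refine ext fun x => ?_
      simp only [sub_apply, add_apply, smul_apply, hv, hl]
      ring
    · refine ext fun x => ?_
      simp only [sub_apply, add_apply, smul_apply, hv, hl]
      linear_combination (u x) * hmul

/-- Decaying perturbation terms after `(D² - 1)⁻¹`. -/
def pertOp (c₁₁ c₁₂ c₂₁ c₂₂ p : BUC) : PhaseSpace →L[ℂ] PhaseSpace :=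
  let p₁ := ContinuousLinearMap.fst ℂ BUC BUC
  let p₂ := ContinuousLinearMap.snd ℂ BUC BUC
  let i₁ := ContinuousLinearMap.inl ℂ BUC BUC
  let i₂ := ContinuousLinearMap.inr ℂ BUC BUC
  i₁ ∘L (mulOp c₁₁ ∘L resOne) ∘L p₁ + i₁ ∘L (mulOp c₁₂ ∘L resOne) ∘L p₂ +
    i₂ ∘L (mulOp c₂₁ ∘L resOne) ∘L p₁ + i₂ ∘L (mulOp c₂₂ ∘L resOne) ∘L p₂ +
    i₂ ∘L (mulOp p ∘L derivResOne) ∘L p₂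

theorem pertOp_apply (c₁₁ c₁₂ c₂₁ c₂₂ p : BUC) (f : PhaseSpace) :
    pertOp c₁₁ c₁₂ c₂₁ c₂₂ p f = (mulOp c₁₁ (resOne f.1) + mulOp c₁₂ (resOne f.2),
      mulOp c₂₁ (resOne f.1) + mulOp c₂₂ (resOne f.2) + mulOp p (derivResOne f.2)) := by
  change (mulOp c₁₁ (resOne f.1), (0 : BUC)) + (mulOp c₁₂ (resOne f.2), 0) +
    (0, mulOp c₂₁ (resOne f.1)) + (0, mulOp c₂₂ (resOne f.2)) + (0, mulOp p (derivResOne f.2)) = _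
  simp only [Prod.mk_add_mk, add_zero, zero_add]

section Perturbation

variable {a b d : ℂ} {c₁₁ c₁₂ c₂₁ c₂₂ p : BUC}
  (h₁₁ : Tendsto c₁₁ (cocompact ℝ) (𝓝 0)) (h₁₂ : Tendsto c₁₂ (cocompact ℝ) (𝓝 0))
  (h₂₁ : Tendsto c₂₁ (cocompact ℝ) (𝓝 0)) (h₂₂ : Tendsto c₂₂ (cocompact ℝ) (𝓝 0))
  (hp : Tendsto p (cocompact ℝ) (𝓝 0))

include h₁₁ h₁₂ h₂₁ h₂₂ hp

theorem pertOp_mem_finiteRankClosure :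
    pertOp c₁₁ c₁₂ c₂₁ c₂₂ p ∈ finiteRankClosure PhaseSpace PhaseSpace := by
  have hR : ∀ {c : BUC}, Tendsto c (cocompact ℝ) (𝓝 0) →
      mulOp c ∘L resOne ∈ finiteRankClosure BUC BUC := fun hc =>
    mulOp_comp_mem_finiteRankClosure hc (norm_nonneg (derivResolventOp re_one_pos))
      (norm_resolventOp_sub_le re_one_pos)
  have hR' : mulOp p ∘L derivResOne ∈ finiteRankClosure BUC BUC :=
    mulOp_comp_mem_finiteRankClosure hp
      (norm_nonneg (ContinuousLinearMap.id ℂ BUC + (1 : ℂ) ^ 2 • resolventOp re_one_pos))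
      (norm_derivResolventOp_sub_le re_one_pos)
  unfold pertOp
  refine finiteRankClosure.add (finiteRankClosure.add (finiteRankClosure.add
    (finiteRankClosure.add ?_ ?_) ?_) ?_) ?_
  · exact finiteRankClosure.comp (hR h₁₁) _ _
  · exact finiteRankClosure.comp (hR h₁₂) _ _
  · exact finiteRankClosure.comp (hR h₂₁) _ _
  · exact finiteRankClosure.comp (hR h₂₂) _ _
  · exact finiteRankClosure.comp hR' _ _

theorem isFredholmIndexZero_constOp_add_pertOp
    (h : ∀ k : ℝ, (a - (k : ℂ) ^ 2) * (d - (k : ℂ) ^ 2) - b ≠ 0) :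
    IsFredholmIndexZero
      ((constOp a b d + pertOp c₁₁ c₁₂ c₂₁ c₂₂ p : PhaseSpace →L[ℂ] PhaseSpace) :
        PhaseSpace →ₗ[ℂ] PhaseSpace) := by
  have hb := constOp_bijective h
  let B : PhaseSpace ≃L[ℂ] PhaseSpace := ContinuousLinearEquiv.ofBijective (constOp a b d)
    (LinearMap.ker_eq_bot.2 hb.1) (LinearMap.range_eq_top.2 hb.2)
  have hB : (B : PhaseSpace →L[ℂ] PhaseSpace) = constOp a b d :=
    ContinuousLinearEquiv.coe_ofBijective _ _ _
  rw [← hB]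
  exact isFredholmIndexZero_equiv_add B (pertOp_mem_finiteRankClosure h₁₁ h₁₂ h₂₁ h₂₂ hp)

end Perturbation


/-! ### Wave packets -/

/-- `θ` modulated by `exp (i k x)`, stretched by the factor `n + 1` and moved to `(n + 1)²`. -/
def packet (θ : ℝ → ℂ) (hθ : Continuous θ) (hs : HasCompactSupport θ) (k : ℝ) (n : ℕ) : BUC :=
  ofDecay (fun x => θ (x / (n + 1) - (n + 1)) * Complex.exp (Complex.I * k * x)) (by fun_prop) (by
    have h1 : Tendsto (fun x : ℝ => x / (n + 1) - (n + 1)) (cocompact ℝ) (cocompact ℝ) :=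
      (((Homeomorph.mulRight₀ ((n + 1 : ℝ)⁻¹) (by positivity)).trans
        (Homeomorph.subRight ((n : ℝ) + 1))).isClosedEmbedding).tendsto_cocompact
    refine squeeze_zero_norm (fun x => ?_) (by
      simpa only [norm_zero, Function.comp_def] using (hs.is_zero_at_infty.comp h1).norm)
    rw [norm_mul, Complex.norm_exp]
    simp)

section Packet

variable {θ : ℝ → ℂ} (hθ : Continuous θ) (hs : HasCompactSupport θ) (k : ℝ)

theorem packet_apply (n : ℕ) (x : ℝ) : packet θ hθ hs k n x
    = θ (x / (n + 1) - (n + 1)) * Complex.exp (Complex.I * k * x) := rfl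

theorem norm_packet_apply (n : ℕ) (x : ℝ) :
    ‖packet θ hθ hs k n x‖ = ‖θ (x / (n + 1) - (n + 1))‖ := by
  rw [packet_apply, norm_mul, Complex.norm_exp]
  simp

/-- Stretching puts the factor `1 / (n + 1)` in front of the derivative of the envelope, so packets
are approximate eigenfunctions of `d/dx` for `i k`. -/
theorem packet_hasDerivAt {θ' : ℝ → ℂ} (hθ' : Continuous θ') (hs' : HasCompactSupport θ')
    (hd : ∀ x, HasDerivAt θ (θ' x) x) (n : ℕ) (x : ℝ) :
    HasDerivAt (packet θ hθ hs k n)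
      (((n + 1 : ℂ)⁻¹ • packet θ' hθ' hs' k n + (Complex.I * k) • packet θ hθ hs k n : BUC) x)
      x := by
  have h1 : HasDerivAt (fun x : ℝ => x / (n + 1) - (n + 1)) (1 / (n + 1) : ℝ) x :=
    ((hasDerivAt_id x).div_const _).sub_const _
  have h2 := (hd (x / (n + 1) - (n + 1))).scomp x h1
  have h3 : HasDerivAt (fun x : ℝ => Complex.exp (Complex.I * k * x))
      (Complex.exp (Complex.I * k * x) * (Complex.I * k)) x := by
    have h : HasDerivAt (fun x : ℝ => Complex.I * k * (x : ℂ)) (Complex.I * k * (1 : ℝ)) x :=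
      (hasDerivAt_id x).ofReal_comp.const_mul _
    rw [Complex.ofReal_one, mul_one] at h
    exact h.cexp
  refine (h2.mul h3).congr_deriv ?_
  simp only [add_apply, smul_apply, packet_apply, Complex.real_smul, Function.comp_apply]
  push_cast
  ring

theorem exists_norm_packet_le : ∃ M, 0 ≤ M ∧ ∀ n, ‖packet θ hθ hs k n‖ ≤ M := by
  obtain ⟨M, hM⟩ := hs.exists_bound_of_continuous hθ
  have h0 : 0 ≤ M := (norm_nonneg _).trans (hM 0)
  exact ⟨M, h0, fun n => (norm_le h0).2 fun x => (norm_packet_apply hθ hs k n x).trans_le (hM _)⟩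

/-- The envelope has centre `(n + 1)²` and half-width `n + 1`, so the support starts no earlier than
`n (n + 1) ≥ n`. -/
theorem packet_apply_eq_zero (hsupp : ∀ x, 1 < |x| → θ x = 0) {n : ℕ} {x : ℝ} (hx : x < n) :
    packet θ hθ hs k n x = 0 := by
  have h1 : (0 : ℝ) < n + 1 := by positivity
  have h2 : x / (n + 1) < 1 - 1 / (n + 1) := by
    rw [div_lt_iff₀ h1, sub_mul, div_mul_cancel₀ _ h1.ne']
    linarith
  have h3 : x / (n + 1) - (n + 1) < -1 := by
    have h4 : (0 : ℝ) ≤ n := Nat.cast_nonneg n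
    rcases Nat.eq_zero_or_pos n with rfl | hn
    · have h5 : x < 0 := by simpa using hx
      norm_num at h2 ⊢
      linarith
    · have h5 : (1 : ℝ) ≤ n := by exact_mod_cast hn
      have h6 : 0 < 1 / ((n : ℝ) + 1) := by positivity
      linarith
  rw [packet_apply, hsupp _ (by rw [lt_abs]; right; linarith), zero_mul]

/-- The packets are uniformly bounded and move into the region where `c` is small. -/
theorem tendsto_mulOp_packet (hsupp : ∀ x, 1 < |x| → θ x = 0) {c : BUC}
    (hc : Tendsto c (cocompact ℝ) (𝓝 0)) :
    Tendsto (fun n => mulOp c (packet θ hθ hs k n)) atTop (𝓝 0) := by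
  obtain ⟨M, hM0, hM⟩ := exists_norm_packet_le hθ hs k
  refine tendsto_zero_iff_norm_tendsto_zero.2 (tendsto_order.2 ⟨fun r hr =>
    Eventually.of_forall fun n => hr.trans_le (norm_nonneg _), fun r hr => ?_⟩)
  have hc' := (hc.mono_left (cocompact_eq_atBot_atTop (α := ℝ) ▸ le_sup_right :
    atTop ≤ cocompact ℝ)).norm
  have hr' : ‖(0 : ℂ)‖ < r / (2 * (M + 1)) := by
    rw [norm_zero]
    positivity
  obtain ⟨X, hX⟩ := eventually_atTop.1 (hc'.eventually (Iic_mem_nhds hr'))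
  filter_upwards [eventually_ge_atTop ⌈X⌉₊] with n hn
  have hle : ‖mulOp c (packet θ hθ hs k n)‖ ≤ r / 2 := by
    refine (norm_le (by positivity)).2 fun x => ?_
    rw [mulOp_apply]
    rcases lt_or_ge x n with hx | hx
    · rw [packet_apply_eq_zero hθ hs k hsupp hx, mul_zero, norm_zero]
      positivity
    · rw [norm_mul]
      have h1 : ‖c x‖ ≤ r / (2 * (M + 1)) :=
        hX x (((Nat.le_ceil X).trans (by exact_mod_cast hn)).trans hx)
      calc ‖c x‖ * ‖packet θ hθ hs k n x‖ ≤ r / (2 * (M + 1)) * M :=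
            mul_le_mul h1 ((norm_apply_le _ _).trans (hM n)) (norm_nonneg _) (by positivity)
        _ ≤ r / (2 * (M + 1)) * (M + 1) := by gcongr; linarith
        _ = r / 2 := by field_simp
  linarith

end Packet

theorem tendsto_inv_smul {E : Type*} [NormedAddCommGroup E] [NormedSpace ℂ E] {f : ℕ → E} {M : ℝ}
    (hM : ∀ n, ‖f n‖ ≤ M) : Tendsto (fun n : ℕ => (n + 1 : ℂ)⁻¹ • f n) atTop (𝓝 0) := by
  refine squeeze_zero_norm (a := fun n : ℕ => 1 / ((n : ℝ) + 1) * M) (fun n => ?_) ?_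
  · rw [norm_smul, norm_inv]
    have : ‖(n + 1 : ℂ)‖ = n + 1 := by
      rw [← Nat.cast_add_one, Complex.norm_natCast, Nat.cast_add_one]
    rw [this, ← one_div]
    exact mul_le_mul_of_nonneg_left (hM n) (by positivity)
  · simpa using (tendsto_one_div_add_atTop_nhds_zero_nat (𝕜 := ℝ)).mul_const M

theorem exists_cutoff : ∃ χ χ₁ χ₂ : ℝ → ℂ, Continuous χ ∧ Continuous χ₁ ∧ Continuous χ₂ ∧
    HasCompactSupport χ ∧ HasCompactSupport χ₁ ∧ HasCompactSupport χ₂ ∧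
    (∀ x, HasDerivAt χ (χ₁ x) x) ∧ (∀ x, HasDerivAt χ₁ (χ₂ x) x) ∧
    (∀ x, 1 < |x| → χ x = 0) ∧ (∀ x, 1 < |x| → χ₁ x = 0) ∧ χ 0 = 1 := by
  obtain ⟨f, hf1, hf2, hf3, -, hf5⟩ := exists_contDiff_tsupport_subset (E := ℝ) (n := ⊤)
    (Ioo_mem_nhds (by norm_num : (-1 : ℝ) < 0) (by norm_num : (0 : ℝ) < 1))
  have hc : ContDiff ℝ ∞ (fun x => (f x : ℂ)) := Complex.ofRealCLM.contDiff.comp hf3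
  have hc1 : ContDiff ℝ ∞ (deriv fun x => (f x : ℂ)) := (contDiff_infty_iff_deriv.1 hc).2
  have hc2 : ContDiff ℝ ∞ (deriv (deriv fun x => (f x : ℂ))) := (contDiff_infty_iff_deriv.1 hc1).2
  have hs : HasCompactSupport (fun x => (f x : ℂ)) := hf2.comp_left Complex.ofReal_zero
  have hsub : tsupport (fun x => (f x : ℂ)) ⊆ Set.Ioo (-1) 1 :=
    by
    refine (closure_mono (Function.support_subset_iff'.2 fun x hx => ?_)).trans hf1
    rw [Function.notMem_support.1 hx, Complex.ofReal_zero]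
  have hout : ∀ x : ℝ, 1 < |x| → x ∉ tsupport (fun x => (f x : ℂ)) := fun x hx h => by
    have := hsub h
    exact absurd (abs_lt.2 this) (not_lt.2 hx.le)
  refine ⟨fun x => (f x : ℂ), _, _, hc.continuous, hc1.continuous, hc2.continuous, hs, hs.deriv,
    hs.deriv.deriv, fun x => (hc.differentiable (by simp) x).hasDerivAt,
    fun x => (hc1.differentiable (by simp) x).hasDerivAt, fun x hx => ?_, fun x hx => ?_, ?_⟩
  · exact image_eq_zero_of_notMem_tsupport (f := fun x => (f x : ℂ)) (hout x hx)
  · exact image_eq_zero_of_notMem_tsupport fun h => hout x hx (tsupport_deriv_subset h)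
  · simp [hf5]

/-- The vanishing determinant makes `(1, β)` with `β = k² - a` a null vector of `A - k²`. Applied to
`(1, β)` times `(D² - 1)` of a packet, the constant part leaves only the `O(1/n)` terms from
derivatives of the envelope, and the perturbation vanishes in the limit because the packets escape.
-/
theorem not_isFredholmIndexZero_constOp_add_pertOp {a b d : ℂ} {c₁₁ c₁₂ c₂₁ c₂₂ p : BUC}
    (h₁₁ : Tendsto c₁₁ (cocompact ℝ) (𝓝 0)) (h₁₂ : Tendsto c₁₂ (cocompact ℝ) (𝓝 0))
    (h₂₁ : Tendsto c₂₁ (cocompact ℝ) (𝓝 0)) (h₂₂ : Tendsto c₂₂ (cocompact ℝ) (𝓝 0))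
    (hp : Tendsto p (cocompact ℝ) (𝓝 0)) {k : ℝ}
    (h : (a - (k : ℂ) ^ 2) * (d - (k : ℂ) ^ 2) - b = 0) :
    ¬ IsFredholmIndexZero
      ((constOp a b d + pertOp c₁₁ c₁₂ c₂₁ c₂₂ p : PhaseSpace →L[ℂ] PhaseSpace) :
        PhaseSpace →ₗ[ℂ] PhaseSpace) := by
  intro hF
  obtain ⟨χ, χ₁, χ₂, hχ, hχ₁, hχ₂, hs, hs₁, hs₂, hd, hd₁, hsupp, hsupp₁, hχ0⟩ := exists_cutoff
  set β : ℂ := (k : ℂ) ^ 2 - a with hβ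
  let ik : ℂ := Complex.I * k
  have hik : ik ^ 2 = -(k : ℂ) ^ 2 := by
    simp only [ik, mul_pow, Complex.I_sq]
    ring
  let P := packet χ hχ hs k
  let P₁ := packet χ₁ hχ₁ hs₁ k
  let P₂ := packet χ₂ hχ₂ hs₂ k
  let N : ℕ → ℂ := fun n => (n + 1 : ℂ)⁻¹
  let D : ℕ → BUC := fun n => N n • P₁ n + ik • P n
  let J : ℕ → BUC := fun n => N n • (N n • P₂ n + (2 * ik) • P₁ n)
  -- `Y n` is `P n'' - P n`, the preimage of the packet under `resOne`; `J n` is the remainder `P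
  -- n'' + k² P n`.
  let Y : ℕ → BUC := fun n => J n - ((k : ℂ) ^ 2 + 1) • P n
  obtain ⟨M, hM0, hM⟩ := exists_norm_packet_le hχ hs k
  obtain ⟨M₁, hM0₁, hM₁⟩ := exists_norm_packet_le hχ₁ hs₁ k
  obtain ⟨M₂, hM0₂, hM₂⟩ := exists_norm_packet_le hχ₂ hs₂ k
  have hPd : ∀ n x, HasDerivAt (P n) (D n x) x := packet_hasDerivAt hχ hs k hχ₁ hs₁ hd
  have hPd₁ : ∀ n x, HasDerivAt (P₁ n) ((N n • P₂ n + ik • P₁ n : BUC) x) x :=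
    packet_hasDerivAt hχ₁ hs₁ k hχ₂ hs₂ hd₁
  have hPd2 : ∀ n, IsSecondDeriv (P n) (J n - (k : ℂ) ^ 2 • P n) := fun n => by
    refine isSecondDeriv_iff.2 ⟨D n, hPd n, fun x => ?_⟩
    refine (((hPd₁ n x).const_mul (N n)).add ((hPd n x).const_mul ik)).congr_deriv ?_
    simp only [D, J, sub_apply, add_apply, smul_apply]
    linear_combination P n x * hik
  have hRY : ∀ n, resOne (Y n) = P n := fun n => by
    have h1 := isSecondDeriv_iff_eq_resOne.1 (hPd2 n)
    have h2 : J n - (k : ℂ) ^ 2 • P n - P n = Y n := by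
      simp only [Y]
      module
    rw [h2] at h1
    exact h1.symm
  have hR'Y : ∀ n, derivResOne (Y n) = D n := fun n => ext fun x => by
    have h1 := resOne_hasDerivAt (Y n) x
    rw [hRY] at h1
    exact h1.unique (hPd n x)
  have hN : ∀ n, ‖N n‖ ≤ 1 := fun n => by
    have : ‖(n + 1 : ℂ)‖ = n + 1 := by
      rw [← Nat.cast_add_one, Complex.norm_natCast, Nat.cast_add_one]
    change ‖(n + 1 : ℂ)⁻¹‖ ≤ 1
    rw [norm_inv, this]
    exact inv_le_one_of_one_le₀ (by linarith [Nat.cast_nonneg (α := ℝ) n])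
  have hJ' : ∀ n, ‖N n • P₂ n + (2 * ik) • P₁ n‖ ≤ 1 * M₂ + ‖2 * ik‖ * M₁ := fun n => by
    refine (norm_add_le _ _).trans ?_
    rw [norm_smul, norm_smul]
    exact add_le_add (mul_le_mul (hN n) (hM₂ n) (norm_nonneg _) zero_le_one)
      (mul_le_mul_of_nonneg_left (hM₁ n) (norm_nonneg _))
  have hJ0 : Tendsto J atTop (𝓝 0) := tendsto_inv_smul hJ'
  let f : ℕ → PhaseSpace := fun n => (Y n, β • Y n)
  have hYb : ∀ n, ‖Y n‖ ≤ 1 * (1 * M₂ + ‖2 * ik‖ * M₁) + ‖(k : ℂ) ^ 2 + 1‖ * M := fun n => by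
    refine (norm_sub_le _ _).trans ?_
    simp only [J]
    rw [norm_smul, norm_smul]
    exact add_le_add (mul_le_mul (hN n) (hJ' n) (norm_nonneg _) zero_le_one)
      (mul_le_mul_of_nonneg_left (hM n) (norm_nonneg _))
  have hfb : ∃ C, ∀ n, ‖f n‖ ≤ C := by
    refine ⟨max (1 * (1 * M₂ + ‖2 * ik‖ * M₁) + ‖(k : ℂ) ^ 2 + 1‖ * M)
      (‖β‖ * (1 * (1 * M₂ + ‖2 * ik‖ * M₁) + ‖(k : ℂ) ^ 2 + 1‖ * M)), fun n => ?_⟩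
    rw [Prod.norm_def]
    refine max_le_max (hYb n) ?_
    change ‖β • Y n‖ ≤ _
    rw [norm_smul]
    exact mul_le_mul_of_nonneg_left (hYb n) (norm_nonneg _)
  obtain ⟨C, hC⟩ := hfb
  have hconst : ∀ n, constOp a b d (f n) = (J n, β • J n) := fun n => by
    rw [constOp_apply]
    simp only [f, map_smul, hRY]
    refine Prod.ext ?_ ?_
    · refine ext fun x => ?_
      simp only [Y, hβ, sub_apply, add_apply, smul_apply]
      ring
    · refine ext fun x => ?_
      simp only [Y, hβ, sub_apply, add_apply, smul_apply]
      linear_combination (-P n x) * h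
  have hmulP : ∀ {c : BUC}, Tendsto c (cocompact ℝ) (𝓝 0) →
      Tendsto (fun n => mulOp c (P n)) atTop (𝓝 0) := fun hc =>
    tendsto_mulOp_packet hχ hs k hsupp hc
  have hmulD : Tendsto (fun n => mulOp p (D n)) atTop (𝓝 0) := by
    have h1 : Tendsto (fun n => N n • mulOp p (P₁ n)) atTop (𝓝 0) :=
      tendsto_inv_smul (M := ‖mulOp p‖ * M₁) fun n => ((mulOp p).le_opNorm _).trans
        (mul_le_mul_of_nonneg_left (hM₁ n) (norm_nonneg _))
    have h2 := h1.add ((hmulP hp).const_smul ik)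
    simp only [smul_zero, add_zero] at h2
    refine h2.congr fun n => ?_
    simp only [D, map_add, map_smul]
  have hpert : ∀ n, pertOp c₁₁ c₁₂ c₂₁ c₂₂ p (f n)
      = (mulOp c₁₁ (P n) + β • mulOp c₁₂ (P n),
        mulOp c₂₁ (P n) + β • mulOp c₂₂ (P n) + β • mulOp p (D n)) := fun n => by
    rw [pertOp_apply]
    simp only [f, map_smul, hRY, hR'Y]
  have hlim : Tendsto (fun n => (constOp a b d + pertOp c₁₁ c₁₂ c₂₁ c₂₂ p :
      PhaseSpace →L[ℂ] PhaseSpace) (f n)) atTop (𝓝 0) := by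
    have h1 : Tendsto (fun n => J n + (mulOp c₁₁ (P n) + β • mulOp c₁₂ (P n))) atTop (𝓝 0) := by
      have := hJ0.add ((hmulP h₁₁).add ((hmulP h₁₂).const_smul β))
      simpa only [smul_zero, add_zero] using this
    have h2 : Tendsto (fun n => β • J n + (mulOp c₂₁ (P n) + β • mulOp c₂₂ (P n)
        + β • mulOp p (D n))) atTop (𝓝 0) := by
      have := (hJ0.const_smul β).add (((hmulP h₂₁).add ((hmulP h₂₂).const_smul β)).add
        (hmulD.const_smul β))
      simpa only [smul_zero, add_zero] using this
    refine (h1.prodMk_nhds h2).congr fun n => ?_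
    rw [_root_.add_apply, hconst, hpert]
    rfl
  obtain ⟨g, φ, hφ, hg⟩ := exists_convergent_subseq_of_isFredholmIndexZero hF hC hlim
  have hPg : Tendsto (fun n => P (φ n)) atTop (𝓝 (resOne g.1)) := by
    have h1 := (resOne.continuous.tendsto _).comp ((continuous_fst.tendsto g).comp hg)
    refine h1.congr fun n => ?_
    exact hRY (φ n)
  -- Uniform limits are pointwise limits, and at each fixed point the packets are eventually zero.
  have hzero : resOne g.1 = 0 := by
    refine ext fun x => tendsto_nhds_unique (((evalOp x).continuous.tendsto _).comp hPg) ?_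
    refine tendsto_const_nhds.congr' ?_
    filter_upwards [eventually_gt_atTop ⌈x⌉₊] with n hn
    have h1 : x < φ n := (Nat.le_ceil x).trans_lt (by exact_mod_cast hn.trans_le (hφ.id_le n))
    exact (packet_apply_eq_zero hχ hs k hsupp h1).symm
  rw [hzero] at hPg
  -- At the centre `(φ n + 1)²` the envelope equals `χ 0 = 1`, so the packets cannot tend to zero in
  -- norm.
  have hone : ∀ n, 1 ≤ ‖P (φ n)‖ := fun n => by
    have h1 := norm_apply_le (P (φ n)) (((φ n : ℝ) + 1) * (φ n + 1))
    rw [norm_packet_apply, mul_div_cancel_right₀ _ (by positivity), sub_self, hχ0, norm_one] at h1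
    exact h1
  have := ge_of_tendsto' (hPg.norm) hone
  rw [norm_zero] at this
  linarith


/-! ### A unimodular function joining the signs of the two background states -/

/-- `exp (i σ (π / 2 - arctan x))`: for `σ = ±1` it tends to `±1` at `±∞`. -/
def phaseFun (σ x : ℝ) : ℂ := Complex.exp ((σ * (Real.pi / 2 - Real.arctan x) : ℝ) * Complex.I)

theorem norm_phaseFun (σ x : ℝ) : ‖phaseFun σ x‖ = 1 := Complex.norm_exp_ofReal_mul_I _

theorem continuous_phaseFun (σ : ℝ) : Continuous (phaseFun σ) := by
  unfold phaseFun
  have := Real.continuous_arctan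
  fun_prop

theorem phaseFun_mul_neg (σ x : ℝ) : phaseFun σ x * phaseFun (-σ) x = 1 := by
  rw [phaseFun, phaseFun, ← Complex.exp_add, ← add_mul, ← Complex.ofReal_add]
  simp

/-- The logarithmic derivative of `phaseFun`. -/
def phaseLogDeriv (σ x : ℝ) : ℂ := ((-(σ / (1 + x ^ 2)) : ℝ) : ℂ) * Complex.I

theorem phaseFun_hasDerivAt (σ x : ℝ) :
    HasDerivAt (phaseFun σ) (phaseLogDeriv σ x * phaseFun σ x) x := by
  have h1 : HasDerivAt (fun x => σ * (Real.pi / 2 - Real.arctan x)) (σ * -(1 / (1 + x ^ 2))) x :=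
    ((Real.hasDerivAt_arctan x).const_sub _).const_mul σ
  have h2 := (h1.ofReal_comp.mul_const Complex.I).cexp
  refine h2.congr_deriv ?_
  rw [phaseLogDeriv, phaseFun, mul_comm]
  congr 3
  ring

/-- The derivative of `phaseLogDeriv`. -/
def phaseLogDeriv₂ (σ x : ℝ) : ℂ := ((σ * (2 * x) / (1 + x ^ 2) ^ 2 : ℝ) : ℂ) * Complex.I

theorem phaseLogDeriv_hasDerivAt (σ x : ℝ) :
    HasDerivAt (phaseLogDeriv σ) (phaseLogDeriv₂ σ x) x := by
  have h0 : (1 + x ^ 2) ≠ 0 := by positivity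
  have h1 : HasDerivAt (fun x : ℝ => -(σ / (1 + x ^ 2))) (σ * (2 * x) / (1 + x ^ 2) ^ 2) x := by
    have h2 : HasDerivAt (fun x : ℝ => 1 + x ^ 2) (2 * x) x := by
      simpa using (hasDerivAt_pow 2 x).const_add 1
    refine (((hasDerivAt_const x σ).div h2 h0).neg).congr_deriv ?_
    ring
  exact h1.ofReal_comp.mul_const Complex.I

theorem tendsto_inv_one_add_sq : Tendsto (fun x : ℝ => (1 + x ^ 2)⁻¹) (cocompact ℝ) (𝓝 0) := by
  have h : Tendsto (fun x : ℝ => ‖x‖ ^ 2) (cocompact ℝ) atTop :=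
    (tendsto_pow_atTop two_ne_zero).comp (tendsto_norm_cocompact_atTop (E := ℝ))
  refine (tendsto_atTop_add_const_left _ 1 h).inv_tendsto_atTop.congr fun x => ?_
  simp

theorem continuous_phaseLogDeriv (σ : ℝ) : Continuous (phaseLogDeriv σ) :=
  continuous_iff_continuousAt.2 fun x => (phaseLogDeriv_hasDerivAt σ x).continuousAt

theorem continuous_phaseLogDeriv₂ (σ : ℝ) : Continuous (phaseLogDeriv₂ σ) := by
  unfold phaseLogDeriv₂
  refine (Complex.continuous_ofReal.comp (Continuous.div (by fun_prop) (by fun_prop) fun x => ?_)).mul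
    continuous_const
  positivity

theorem norm_phaseLogDeriv (σ x : ℝ) : ‖phaseLogDeriv σ x‖ = |σ| * (1 + x ^ 2)⁻¹ := by
  rw [phaseLogDeriv, norm_mul, Complex.norm_I, mul_one, Complex.norm_real, norm_neg,
    Real.norm_eq_abs, abs_div, abs_of_pos (by positivity : (0 : ℝ) < 1 + x ^ 2), div_eq_mul_inv]

theorem tendsto_phaseLogDeriv (σ : ℝ) : Tendsto (phaseLogDeriv σ) (cocompact ℝ) (𝓝 0) := by
  refine squeeze_zero_norm (fun x => (norm_phaseLogDeriv σ x).le) ?_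
  simpa using tendsto_inv_one_add_sq.const_mul |σ|

theorem tendsto_phaseLogDeriv₂ (σ : ℝ) : Tendsto (phaseLogDeriv₂ σ) (cocompact ℝ) (𝓝 0) := by
  refine squeeze_zero_norm (a := fun x => |σ| * (1 + x ^ 2)⁻¹) (fun x => ?_) ?_
  · have h0 : (0 : ℝ) < 1 + x ^ 2 := by positivity
    rw [phaseLogDeriv₂, norm_mul, Complex.norm_I, mul_one, Complex.norm_real, Real.norm_eq_abs,
      abs_div, abs_mul, abs_of_pos (pow_pos h0 2), div_le_iff₀ (pow_pos h0 2), pow_two (1 + x ^ 2),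
      mul_assoc, inv_mul_cancel_left₀ h0.ne']
    refine mul_le_mul_of_nonneg_left (abs_le.2 ⟨?_, ?_⟩) (abs_nonneg σ) <;>
      nlinarith [sq_nonneg (x - 1), sq_nonneg (x + 1)]
  · simpa using tendsto_inv_one_add_sq.const_mul |σ|

/-- `phaseFun` as an element of `BUC`. -/
def phase (σ : ℝ) : BUC :=
  mk (phaseFun σ)
    (uniformContinuous_of_hasDerivAt (phaseFun_hasDerivAt σ) (C := |σ|) fun x => by
      rw [norm_mul, norm_phaseFun, mul_one, norm_phaseLogDeriv]
      refine mul_le_of_le_one_right (abs_nonneg σ) (inv_le_one_of_one_le₀ ?_)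
      linarith [sq_nonneg x])
    ⟨1, fun x => (norm_phaseFun σ x).le⟩

theorem phase_apply (σ x : ℝ) : phase σ x = phaseFun σ x := rfl

/-- The first order coefficient created by conjugation with `phase σ`. -/
def phaseDrift (σ : ℝ) : BUC :=
  (2 : ℂ) • ofDecay (phaseLogDeriv σ) (continuous_phaseLogDeriv σ) (tendsto_phaseLogDeriv σ)

theorem phaseDrift_apply (σ x : ℝ) : phaseDrift σ x = 2 * phaseLogDeriv σ x := rfl

theorem tendsto_phaseDrift (σ : ℝ) : Tendsto (phaseDrift σ) (cocompact ℝ) (𝓝 0) := by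
  have h := (tendsto_phaseLogDeriv σ).const_mul 2
  rw [mul_zero] at h
  exact h

theorem tendsto_phasePotential (σ : ℝ) :
    Tendsto (fun x => phaseLogDeriv₂ σ x + phaseLogDeriv σ x ^ 2) (cocompact ℝ) (𝓝 0) := by
  simpa using (tendsto_phaseLogDeriv₂ σ).add ((tendsto_phaseLogDeriv σ).pow 2)

/-- The zeroth order coefficient created by conjugation with `phase σ`. -/
def phasePotential (σ : ℝ) : BUC :=
  ofDecay (fun x => phaseLogDeriv₂ σ x + phaseLogDeriv σ x ^ 2)
    ((continuous_phaseLogDeriv₂ σ).add ((continuous_phaseLogDeriv σ).pow 2))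
    (tendsto_phasePotential σ)

theorem phasePotential_apply (σ x : ℝ) :
    phasePotential σ x = phaseLogDeriv₂ σ x + phaseLogDeriv σ x ^ 2 := rfl

/-- With `q` the logarithmic derivative of the phase, conjugation turns `D²` into `D² + 2 q D + (q'
+ q²)`; the terms in `q` decay. -/
theorem isSecondDeriv_phase_mul_resOne (σ : ℝ) (h : BUC) :
    IsSecondDeriv (mulOp (phase σ) (resOne h)) (mulOp (phase σ) (h + resOne h +
      mulOp (phaseDrift σ) (derivResOne h) + mulOp (phasePotential σ) (resOne h))) := by
  refine isSecondDeriv_iff.2 ⟨fun x => phaseFun σ x *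
    (phaseLogDeriv σ x * resOne h x + derivResOne h x), fun x => ?_, fun x => ?_⟩
  · refine ((phaseFun_hasDerivAt σ x).mul (resOne_hasDerivAt h x)).congr_deriv ?_
    ring
  · refine ((phaseFun_hasDerivAt σ x).mul (((phaseLogDeriv_hasDerivAt σ x).mul
      (resOne_hasDerivAt h x)).add (derivResOne_hasDerivAt h x))).congr_deriv ?_
    simp only [mulOp_apply, add_apply, phase_apply, phaseDrift_apply, phasePotential_apply,
      Pi.mul_apply, Pi.add_apply]
    ring

theorem mulOp_phase_neg (σ : ℝ) (f : BUC) : mulOp (phase σ) (mulOp (phase (-σ)) f) = f := by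
  refine ext fun x => ?_
  rw [mulOp_apply, mulOp_apply, ← mul_assoc, phase_apply, phase_apply, phaseFun_mul_neg, one_mul]

theorem tendsto_phaseFun_atTop (σ : ℝ) : Tendsto (phaseFun σ) atTop (𝓝 1) := by
  have h1 : Tendsto (fun x => σ * (Real.pi / 2 - Real.arctan x)) atTop (𝓝 0) := by
    have h := ((tendsto_nhds_of_tendsto_nhdsWithin Real.tendsto_arctan_atTop).const_sub
      (Real.pi / 2)).const_mul σ
    simpa using h
  have h2 : Continuous fun t : ℝ => Complex.exp ((t : ℂ) * Complex.I) := by fun_prop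
  have h3 := (h2.tendsto 0).comp h1
  rw [Complex.ofReal_zero, zero_mul, Complex.exp_zero] at h3
  exact h3

theorem tendsto_phaseFun_atBot (σ : ℝ) :
    Tendsto (phaseFun σ) atBot (𝓝 (Complex.exp ((σ * Real.pi : ℝ) * Complex.I))) := by
  have h1 : Tendsto (fun x => σ * (Real.pi / 2 - Real.arctan x)) atBot (𝓝 (σ * Real.pi)) := by
    have h := ((tendsto_nhds_of_tendsto_nhdsWithin Real.tendsto_arctan_atBot).const_sub
      (Real.pi / 2)).const_mul σ
    have e : σ * (Real.pi / 2 - -(Real.pi / 2)) = σ * Real.pi := by ring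
    rw [e] at h
    exact h
  have h2 : Continuous fun t : ℝ => Complex.exp ((t : ℂ) * Complex.I) := by fun_prop
  exact (h2.tendsto _).comp h1

theorem tendsto_phaseFun_one_atBot : Tendsto (phaseFun 1) atBot (𝓝 (-1)) := by
  have h := tendsto_phaseFun_atBot 1
  rwa [one_mul, Complex.exp_pi_mul_I] at h

theorem tendsto_phaseFun_neg_one_atBot : Tendsto (phaseFun (-1)) atBot (𝓝 (-1)) := by
  have h := tendsto_phaseFun_atBot (-1)
  have e : Complex.exp ((-1 * Real.pi : ℝ) * Complex.I) = -1 := by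
    rw [neg_one_mul, Complex.ofReal_neg, neg_mul, Complex.exp_neg, Complex.exp_pi_mul_I]
    norm_num
  rwa [e] at h

end BUC

/-! ### Coefficients of the linearization -/

/-- Expressing the partial derivative through the total one makes its joint continuity in both
variables available. -/
theorem deriv_fst_eq_fderiv {H : ℝ → ℝ → ℝ} (hH : ContDiff ℝ ∞ (Function.uncurry H)) (s V : ℝ) :
    deriv (fun s => H s V) s = fderiv ℝ (Function.uncurry H) (s, V) (1, 0) := by
  have h1 := ((hH.differentiable (by simp)) (s, V)).hasFDerivAt
  have h2 : HasDerivAt (fun s : ℝ => (s, V)) (1, 0) s :=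
    (hasDerivAt_id s).prodMk (hasDerivAt_const s V)
  exact (h1.comp_hasDerivAt s h2).deriv

theorem deriv_snd_eq_fderiv {H : ℝ → ℝ → ℝ} (hH : ContDiff ℝ ∞ (Function.uncurry H)) (s V : ℝ) :
    deriv (fun w => H s w) V = fderiv ℝ (Function.uncurry H) (s, V) (0, 1) := by
  have h1 := ((hH.differentiable (by simp)) (s, V)).hasFDerivAt
  have h2 : HasDerivAt (fun w : ℝ => (s, w)) (0, 1) V :=
    (hasDerivAt_const V s).prodMk (hasDerivAt_id V)
  exact (h1.comp_hasDerivAt V h2).deriv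

theorem continuous_coeffU {H : ℝ → ℝ → ℝ} (hH : ContDiff ℝ ∞ (Function.uncurry H)) :
    Continuous fun z : ℝ × ℝ => coeffU H z.1 z.2 := by
  have h1 : Continuous fun z : ℝ × ℝ => H (z.1 ^ 2) z.2 :=
    hH.continuous.comp (by fun_prop : Continuous fun z : ℝ × ℝ => (z.1 ^ 2, z.2))
  have h2 : Continuous fun z : ℝ × ℝ => fderiv ℝ (Function.uncurry H) (z.1 ^ 2, z.2) (1, 0) :=
    ((hH.continuous_fderiv (by simp)).comp
      (by fun_prop : Continuous fun z : ℝ × ℝ => (z.1 ^ 2, z.2))).clm_apply continuous_const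
  simp only [coeffU, deriv_fst_eq_fderiv hH]
  fun_prop

theorem continuous_coeffV {H : ℝ → ℝ → ℝ} (hH : ContDiff ℝ ∞ (Function.uncurry H))
    {G : ℝ → ℝ} (hG : ContDiff ℝ ∞ G) : Continuous fun z : ℝ × ℝ => coeffV H G z.1 z.2 := by
  have h1 : Continuous fun z : ℝ × ℝ => H (z.1 ^ 2) z.2 :=
    hH.continuous.comp (by fun_prop : Continuous fun z : ℝ × ℝ => (z.1 ^ 2, z.2))
  have h2 : Continuous fun z : ℝ × ℝ => fderiv ℝ (Function.uncurry H) (z.1 ^ 2, z.2) (0, 1) :=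
    ((hH.continuous_fderiv (by simp)).comp
      (by fun_prop : Continuous fun z : ℝ × ℝ => (z.1 ^ 2, z.2))).clm_apply continuous_const
  have h3 : Continuous fun z : ℝ × ℝ => deriv G z.2 :=
    (hG.continuous_deriv (by simp)).comp continuous_snd
  simp only [coeffV, deriv_snd_eq_fderiv hH]
  fun_prop

/-- A continuous function with equal limits at both ends is that limit plus a decaying element of
`BUC`. -/
theorem exists_BUC_eq_sub {c : ℝ → ℂ} (hc : Continuous c) {l : ℂ} (h₁ : Tendsto c atTop (𝓝 l))
    (h₂ : Tendsto c atBot (𝓝 l)) :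
    ∃ κ : BUC, Tendsto κ (cocompact ℝ) (𝓝 0) ∧ ∀ x, c x = l + κ x := by
  have h : Tendsto (fun x => c x - l) (cocompact ℝ) (𝓝 0) := by
    rw [cocompact_eq_atBot_atTop, tendsto_sup]
    exact ⟨by simpa using h₂.sub_const l, by simpa using h₁.sub_const l⟩
  exact ⟨BUC.ofDecay (fun x => c x - l) (hc.sub continuous_const) h, h, fun x => by
    rw [BUC.ofDecay_apply, add_sub_cancel]⟩

section Front

variable {ε : ℝ} {H : ℝ → ℝ → ℝ} {G : ℝ → ℝ} {Uh Vh : ℝ → ℝ}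

/-- At `(±1, 0)` the factor `1 + V - U²` vanishes, so no derivative of `H` survives in the limits.
The diagonal limits agree at both ends; the off-diagonal ones differ by a sign, which a phase factor
absorbs. -/
theorem IsFront.exists_coeffs (hH : ContDiff ℝ ∞ (Function.uncurry H)) (hG : ContDiff ℝ ∞ G)
    (hf : IsFront ε H G Uh Vh) :
    ∃ κ₁₁ κ₁₂ κ₂₁ κ₂₂ : BUC,
      (Tendsto κ₁₁ (cocompact ℝ) (𝓝 0) ∧ Tendsto κ₁₂ (cocompact ℝ) (𝓝 0) ∧
        Tendsto κ₂₁ (cocompact ℝ) (𝓝 0) ∧ Tendsto κ₂₂ (cocompact ℝ) (𝓝 0)) ∧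
      (∀ x, ((1 + Vh x - 3 * Uh x ^ 2 : ℝ) : ℂ) = -2 + κ₁₁ x) ∧
      (∀ x, ((Uh x : ℝ) : ℂ) = BUC.phaseFun (-1) x * (1 + κ₁₂ x)) ∧
      (∀ x, ((ε ^ 2 : ℝ) : ℂ) * ((coeffU H (Uh x) (Vh x) : ℝ) : ℂ)
        = BUC.phaseFun 1 x * (-2 * (ε : ℂ) ^ 2 * (H 1 0 : ℂ) + κ₂₁ x)) ∧
      (∀ x, ((ε ^ 2 : ℝ) : ℂ) * ((coeffV H G (Uh x) (Vh x) : ℝ) : ℂ)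
        = (ε : ℂ) ^ 2 * ((H 1 0 : ℂ) + ((deriv G 0 : ℝ) : ℂ)) + κ₂₂ x) := by
  have hU := hf.contDiff_U.continuous
  have hV := hf.contDiff_V.continuous
  have hUV : Continuous fun x => (Uh x, Vh x) := hU.prodMk hV
  have hT : Tendsto (fun x => (Uh x, Vh x)) atTop (𝓝 (1, 0)) :=
    hf.tendsto_U_atTop.prodMk_nhds hf.tendsto_V_atTop
  have hB : Tendsto (fun x => (Uh x, Vh x)) atBot (𝓝 (-1, 0)) :=
    hf.tendsto_U_atBot.prodMk_nhds hf.tendsto_V_atBot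
  have hof : ∀ {F : ℝ × ℝ → ℝ} (_ : Continuous F) {l : Filter ℝ} {z : ℝ × ℝ},
      Tendsto (fun x => (Uh x, Vh x)) l (𝓝 z) →
      Tendsto (fun x => ((F (Uh x, Vh x) : ℝ) : ℂ)) l (𝓝 ((F z : ℝ) : ℂ)) :=
    fun hF _ z hz => ((Complex.continuous_ofReal.comp hF).tendsto z).comp hz
  have c₁ : Continuous fun z : ℝ × ℝ => 1 + z.2 - 3 * z.1 ^ 2 := by fun_prop
  have c₂ := continuous_coeffU hH
  have c₃ := continuous_coeffV hH hG
  obtain ⟨κ₁₁, d₁₁, e₁₁⟩ := exists_BUC_eq_sub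
    (c := fun x => ((1 + Vh x - 3 * Uh x ^ 2 : ℝ) : ℂ)) (l := -2)
    (Complex.continuous_ofReal.comp (c₁.comp hUV))
    (by convert hof c₁ hT using 2; norm_num) (by convert hof c₁ hB using 2; norm_num)
  obtain ⟨κ₁₂, d₁₂, e₁₂⟩ := exists_BUC_eq_sub
    (c := fun x => BUC.phaseFun 1 x * ((Uh x : ℝ) : ℂ)) (l := 1)
    ((BUC.continuous_phaseFun 1).mul (Complex.continuous_ofReal.comp hU))
    (by convert (BUC.tendsto_phaseFun_atTop 1).mul (hof continuous_fst hT) using 2; norm_num)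
    (by convert BUC.tendsto_phaseFun_one_atBot.mul (hof continuous_fst hB) using 2; norm_num)
  obtain ⟨κ₂₁, d₂₁, e₂₁⟩ := exists_BUC_eq_sub
    (c := fun x => BUC.phaseFun (-1) x *
      (((ε ^ 2 : ℝ) : ℂ) * ((coeffU H (Uh x) (Vh x) : ℝ) : ℂ)))
    (l := -2 * (ε : ℂ) ^ 2 * (H 1 0 : ℂ))
    ((BUC.continuous_phaseFun (-1)).mul
      (continuous_const.mul (Complex.continuous_ofReal.comp (c₂.comp hUV))))
    (by
      convert (BUC.tendsto_phaseFun_atTop (-1)).mul ((hof c₂ hT).const_mul _) using 2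
      simp [coeffU]
      ring)
    (by
      convert BUC.tendsto_phaseFun_neg_one_atBot.mul ((hof c₂ hB).const_mul _) using 2
      simp [coeffU]
      ring)
  obtain ⟨κ₂₂, d₂₂, e₂₂⟩ := exists_BUC_eq_sub
    (c := fun x => ((ε ^ 2 : ℝ) : ℂ) * ((coeffV H G (Uh x) (Vh x) : ℝ) : ℂ))
    (l := (ε : ℂ) ^ 2 * ((H 1 0 : ℂ) + ((deriv G 0 : ℝ) : ℂ)))
    (continuous_const.mul (Complex.continuous_ofReal.comp (c₃.comp hUV)))
    (by convert (hof c₃ hT).const_mul _ using 2; simp [coeffV])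
    (by convert (hof c₃ hB).const_mul _ using 2; simp [coeffV])
  refine ⟨κ₁₁, κ₁₂, κ₂₁, κ₂₂, ⟨d₁₁, d₁₂, d₂₁, d₂₂⟩, e₁₁, fun x => ?_, fun x => ?_, e₂₂⟩
  · have h1 := BUC.phaseFun_mul_neg 1 x
    rw [← e₁₂ x]
    linear_combination (-(Uh x : ℂ)) * h1
  · have h1 := BUC.phaseFun_mul_neg 1 x
    rw [← e₂₁ x]
    linear_combination (-(((ε ^ 2 : ℝ) : ℂ) * ((coeffU H (Uh x) (Vh x) : ℝ) : ℂ))) * h1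

end Front

/-! ### Reduction of the linearization to a decaying perturbation of a constant system -/

/-- Multiplication of the second component by `c · phase 1`. -/
def phaseEquiv (c : ℂ) (hc : c ≠ 0) : PhaseSpace ≃L[ℂ] PhaseSpace :=
  (ContinuousLinearEquiv.refl ℂ BUC).prodCongr
    (ContinuousLinearEquiv.equivOfInverse (c • BUC.mulOp (BUC.phase 1))
      (c⁻¹ • BUC.mulOp (BUC.phase (-1)))
      (fun f => by
        have h := BUC.mulOp_phase_neg (-1) f
        rw [neg_neg] at h
        change c⁻¹ • BUC.mulOp (BUC.phase (-1)) (c • BUC.mulOp (BUC.phase 1) f) = f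
        rw [map_smul, h, inv_smul_smul₀ hc])
      (fun f => by
        change c • BUC.mulOp (BUC.phase 1) (c⁻¹ • BUC.mulOp (BUC.phase (-1)) f) = f
        rw [map_smul, BUC.mulOp_phase_neg, smul_inv_smul₀ hc]))

/-- The pair of functions with given data: `(D² - 1)⁻¹` in both components and multiplication of
the second one by `phase 1`. -/
def phaseResOne : PhaseSpace →ₗ[ℂ] PhaseSpace where
  toFun f := (BUC.resOne f.1, BUC.mulOp (BUC.phase 1) (BUC.resOne f.2))
  map_add' f g := by simp only [Prod.fst_add, Prod.snd_add, map_add, Prod.mk_add_mk]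
  map_smul' c f := by simp only [Prod.smul_fst, Prod.smul_snd, map_smul, RingHom.id_apply,
    Prod.smul_mk]

theorem phaseResOne_apply (f : PhaseSpace) :
    phaseResOne f = (BUC.resOne f.1, BUC.mulOp (BUC.phase 1) (BUC.resOne f.2)) := rfl

theorem phaseResOne_injective : Function.Injective phaseResOne := by
  have hR : ∀ f : BUC, BUC.resOne f = 0 → f = 0 := fun f hf => by
    have h1 := BUC.isSecondDeriv_resOne f
    rw [hf, add_zero] at h1
    have h2 := BUC.IsSecondDeriv.smul 0 h1
    rw [zero_smul ℂ, zero_smul ℂ] at h2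
    exact h1.unique h2
  refine (injective_iff_map_eq_zero _).2 fun f hf => ?_
  rw [phaseResOne_apply, Prod.mk_eq_zero] at hf
  refine Prod.ext (hR _ hf.1) (hR _ ?_)
  have h1 := BUC.mulOp_phase_neg (-1) (BUC.resOne f.2)
  rw [neg_neg, hf.2, map_zero] at h1
  exact h1.symm

/-- Multiplication by the inverse phase keeps `v` in the domain of `D²`, so it is again of the form
`resOne h`. This gives surjectivity onto the maximal domain. -/
theorem mem_range_phaseResOne {u v g₁ g₂ : BUC} (hu : BUC.IsSecondDeriv u g₁)
    (hv : BUC.IsSecondDeriv v g₂) : ∃ f, phaseResOne f = (u, v) := by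
  have hv' := BUC.isSecondDeriv_iff_eq_resOne.1 hv
  have h1 := BUC.isSecondDeriv_phase_mul_resOne (-1) (g₂ - v)
  rw [BUC.isSecondDeriv_iff_eq_resOne, ← hv'] at h1
  obtain ⟨h, hh⟩ : ∃ h, BUC.mulOp (BUC.phase (-1)) v = BUC.resOne h := ⟨_, h1⟩
  refine ⟨(g₁ - u, h), ?_⟩
  rw [phaseResOne_apply]
  dsimp only
  rw [← BUC.isSecondDeriv_iff_eq_resOne.1 hu, ← hh, BUC.mulOp_phase_neg]

section Linearization

variable {ε τ : ℝ} {H : ℝ → ℝ → ℝ} {G : ℝ → ℝ} {Uh Vh : ℝ → ℝ}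

/-- Uniqueness of the image replaces the one picked by `choose` by any known image. -/
theorem linearization_shift_apply {w f : PhaseSpace} (h : IsImage ε τ H G Uh Vh w f) (lam : ℂ) :
    (linearization ε τ H G Uh Vh).shift lam ⟨w, f, h⟩ = f - lam • w := by
  have hw : ∃ f, IsImage ε τ H G Uh Vh w f := ⟨f, h⟩
  change hw.choose - lam • w = f - lam • w
  rw [hw.choose_spec.unique h]

/-- The substitution `phaseResOne` is a linear bijection `e` onto the domain, and `T = N⁻¹ (L - λ)
e` is the constant operator plus its decaying perturbation. The isomorphism `N` undoes both the
phase and the prefactor `(ε² τ)⁻¹` of the second equation. -/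
theorem isFredholmIndexZero_shift_iff (hε : 0 < ε) (hτ : 0 < τ)
    (hH : ContDiff ℝ ∞ (Function.uncurry H)) (hG : ContDiff ℝ ∞ G)
    (hf : IsFront ε H G Uh Vh) (lam : ℂ) :
    IsFredholmIndexZero ((linearization ε τ H G Uh Vh).shift lam) ↔
      ∀ k : ℝ, dispersion ε τ (H 1 0) (deriv G 0) lam k ≠ 0 := by
  obtain ⟨κ₁₁, κ₁₂, κ₂₁, κ₂₂, ⟨d₁₁, d₁₂, d₂₁, d₂₂⟩, e₁₁, e₁₂, e₂₁, e₂₂⟩ := hf.exists_coeffs hH hG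
  have hετ : ((ε ^ 2 * τ : ℝ) : ℂ) ≠ 0 := by
    rw [Complex.ofReal_ne_zero]
    positivity
  set a : ℂ := -2 - lam with ha
  set b : ℂ := -2 * (ε : ℂ) ^ 2 * (H 1 0 : ℂ) with hb
  set d : ℂ := (ε : ℂ) ^ 2 * ((H 1 0 : ℂ) + ((deriv G 0 : ℝ) : ℂ)) - ((ε ^ 2 * τ : ℝ) : ℂ) * lam
    with hd
  have hdisp : ∀ k : ℝ, dispersion ε τ (H 1 0) (deriv G 0) lam k
      = (a - (k : ℂ) ^ 2) * (d - (k : ℂ) ^ 2) - b := fun k => by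
    rw [dispersion, ha, hb, hd]
    push_cast
    ring
  set T : PhaseSpace →L[ℂ] PhaseSpace := BUC.constOp a b d +
    BUC.pertOp κ₁₁ κ₁₂ κ₂₁ (κ₂₂ + BUC.phasePotential 1) (BUC.phaseDrift 1) with hT
  set N := phaseEquiv ((ε ^ 2 * τ : ℝ) : ℂ)⁻¹ (inv_ne_zero hετ) with hN
  have himage : ∀ f, IsImage ε τ H G Uh Vh (phaseResOne f) (lam • phaseResOne f + N (T f)) := by
    intro f
    have hu := BUC.isSecondDeriv_resOne f.1
    have hv := BUC.isSecondDeriv_phase_mul_resOne 1 f.2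
    refine ⟨hu.1, hv.1, fun ξ => ⟨?_, ?_⟩⟩
    · change lam * BUC.resOne f.1 ξ + (T f).1 ξ = _
      rw [hT, add_apply, BUC.constOp_apply, BUC.pertOp_apply, linU, phaseResOne_apply]
      dsimp only
      rw [hu.2, e₁₁, e₁₂]
      simp only [Prod.fst_add, BUC.add_apply, BUC.smul_apply, BUC.mulOp_apply, BUC.phase_apply]
      linear_combination (-(1 + κ₁₂ ξ) * BUC.resOne f.2 ξ) * BUC.phaseFun_mul_neg 1 ξ
    · change lam * (BUC.phaseFun 1 ξ * BUC.resOne f.2 ξ) +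
        ((ε ^ 2 * τ : ℝ) : ℂ)⁻¹ * (BUC.phaseFun 1 ξ * (T f).2 ξ) = _
      rw [hT, add_apply, BUC.constOp_apply, BUC.pertOp_apply, linV, phaseResOne_apply]
      dsimp only
      rw [hv.2, mul_add ((ε ^ 2 : ℝ) : ℂ), ← mul_assoc ((ε ^ 2 : ℝ) : ℂ),
        ← mul_assoc ((ε ^ 2 : ℝ) : ℂ), e₂₁, e₂₂]
      simp only [Prod.snd_add, BUC.add_apply, BUC.smul_apply, BUC.mulOp_apply, BUC.phase_apply, hd]
      field_simp
      ring
  let e₀ : PhaseSpace →ₗ[ℂ] (linearization ε τ H G Uh Vh).domain :=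
    phaseResOne.codRestrict _ fun f => ⟨_, himage f⟩
  have he₀ : Function.Bijective e₀ := by
    refine ⟨fun f g hfg => phaseResOne_injective (congrArg Subtype.val hfg), ?_⟩
    rintro ⟨w, g, hw⟩
    -- Solving the two equations for the second derivatives shows that these lie in `BUC`, although
    -- the domain only asks for `C²` functions with image in the space.
    have hu : BUC.IsSecondDeriv w.1 (g.1 - ((-2 : ℂ) • w.1 + BUC.mulOp κ₁₁ w.1) -
        BUC.mulOp (BUC.phase (-1)) (w.2 + BUC.mulOp κ₁₂ w.2)) := by
      refine ⟨hw.1, fun x => ?_⟩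
      have h1 := (hw.2.2 x).1
      rw [linU, e₁₁, e₁₂] at h1
      simp only [BUC.sub_apply, BUC.add_apply, BUC.smul_apply, BUC.mulOp_apply, BUC.phase_apply]
      linear_combination -h1
    have hv : BUC.IsSecondDeriv w.2 (((ε ^ 2 * τ : ℝ) : ℂ) • g.2 -
        BUC.mulOp (BUC.phase 1) (b • w.1 + BUC.mulOp κ₂₁ w.1) -
        (((ε : ℂ) ^ 2 * ((H 1 0 : ℂ) + ((deriv G 0 : ℝ) : ℂ))) • w.2 + BUC.mulOp κ₂₂ w.2)) := by
      refine ⟨hw.2.1, fun x => ?_⟩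
      have h1 := (hw.2.2 x).2
      rw [linV, mul_add ((ε ^ 2 : ℝ) : ℂ), ← mul_assoc ((ε ^ 2 : ℝ) : ℂ),
        ← mul_assoc ((ε ^ 2 : ℝ) : ℂ), e₂₁, e₂₂, eq_inv_mul_iff_mul_eq₀ hετ] at h1
      simp only [BUC.sub_apply, BUC.add_apply, BUC.smul_apply, BUC.mulOp_apply, BUC.phase_apply]
      linear_combination -h1
    obtain ⟨f, hf⟩ := mem_range_phaseResOne hu hv
    exact ⟨f, Subtype.ext hf⟩
  let e := LinearEquiv.ofBijective e₀ he₀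
  have hcomp : (T : PhaseSpace →ₗ[ℂ] PhaseSpace) = (N.symm : PhaseSpace →ₗ[ℂ] PhaseSpace) ∘ₗ
      (linearization ε τ H G Uh Vh).shift lam ∘ₗ (e : PhaseSpace →ₗ[ℂ] _) := by
    refine LinearMap.ext fun f => ?_
    have h1 := linearization_shift_apply (himage f) lam
    rw [add_sub_cancel_left] at h1
    change T f = N.symm ((linearization ε τ H G Uh Vh).shift lam ⟨phaseResOne f, _, himage f⟩)
    rw [h1, ContinuousLinearEquiv.symm_apply_apply]
  rw [← isFredholmIndexZero_comp_equiv_iff e N.symm, ← hcomp]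
  have d₂₂' : Tendsto (κ₂₂ + BUC.phasePotential 1 : BUC) (cocompact ℝ) (𝓝 0) := by
    have h := d₂₂.add (BUC.tendsto_phasePotential 1)
    rw [add_zero] at h
    exact h
  constructor
  · intro hF k hk
    rw [hdisp] at hk
    exact BUC.not_isFredholmIndexZero_constOp_add_pertOp d₁₁ d₁₂ d₂₁ d₂₂'
      (BUC.tendsto_phaseDrift 1) hk hF
  · intro h
    exact BUC.isFredholmIndexZero_constOp_add_pertOp d₁₁ d₁₂ d₂₁ d₂₂' (BUC.tendsto_phaseDrift 1)
      fun k => by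
        rw [← hdisp]
        exact h k

end Linearization

end

/-! ### Location of the roots of the characteristic function -/

theorem re_neg_of_quadratic_eq_zero {A B C : ℝ} (hA : 0 < A) (hB : 0 < B) (hC : 0 < C) {z : ℂ}
    (hz : (A : ℂ) * z ^ 2 + B * z + C = 0) : z.re < 0 := by
  by_contra! h
  have h1 := congrArg Complex.re hz
  have h2 := congrArg Complex.im hz
  simp [pow_two] at h1 h2
  -- If `Re z ≥ 0`, the imaginary part of the equation forces `z` to be real, and then all terms are
  -- nonnegative with `C > 0`.
  have h3 : z.im * (2 * A * z.re + B) = 0 := by linear_combination h2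
  have h4 : 0 < 2 * A * z.re + B := by positivity
  have h5 : z.im = 0 := (mul_eq_zero.1 h3).resolve_right h4.ne'
  rw [h5] at h1
  nlinarith [mul_nonneg hA.le (mul_nonneg h h), mul_nonneg hB.le h]

theorem re_neg_of_dispersion_eq_zero {ε τ H₀ G₁ : ℝ} (hε : 0 < ε) (hτ : 0 < τ)
    (hετ : ε ^ 2 * τ ≤ 1) (hG : G₁ < 0) (hH : H₀ + G₁ - 2 * τ < 0) {lam : ℂ} {k : ℝ}
    (h : dispersion ε τ H₀ G₁ lam k = 0) : lam.re < 0 := by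
  have hε2 : 0 < ε ^ 2 := by positivity
  have h1 : 0 < ε ^ 2 * (2 * τ - (H₀ + G₁)) := mul_pos hε2 (by linarith)
  -- `Q` is expanded in powers of `λ`. The bound `H₀ + G₁ < 2 τ` makes `B` positive; together with
  -- `ε² τ ≤ 1` it gives `ε² (H₀ + G₁) < 2`, hence a positive coefficient of `k²` in `C`, and `G₁ <
  -- 0` makes the constant term of `C` positive.
  refine re_neg_of_quadratic_eq_zero (A := ε ^ 2 * τ)
    (B := ε ^ 2 * τ * k ^ 2 + k ^ 2 + ε ^ 2 * (2 * τ - (H₀ + G₁)))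
    (C := k ^ 4 + k ^ 2 * (2 - ε ^ 2 * (H₀ + G₁)) + 2 * (ε ^ 2 * (-G₁)))
    (by positivity) (by positivity) ?_ ?_
  · have h2 : 0 ≤ k ^ 2 * (2 - ε ^ 2 * (H₀ + G₁)) := mul_nonneg (sq_nonneg k) (by linarith)
    have h3 : 0 < ε ^ 2 * (-G₁) := mul_pos hε2 (by linarith)
    positivity
  · rw [dispersion] at h
    push_cast
    linear_combination h

theorem mainTheorem5 (ε τ : ℝ) (hε : 0 < ε) (hτ : 0 < τ)
    (H : ℝ → ℝ → ℝ) (hH : ContDiff ℝ ∞ (Function.uncurry H))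
    (G : ℝ → ℝ) (hG : ContDiff ℝ ∞ G) (hG0 : G 0 = 0)
    (Uh Vh : ℝ → ℝ) (hfront : IsFront ε H G Uh Vh) :
    essentialSpectrum (linearization ε τ H G Uh Vh)
        = {lam : ℂ | ∃ k : ℝ, dispersion ε τ (H 1 0) (deriv G 0) lam k = 0} ∧
      (ε ^ 2 * τ ≤ 1 → deriv G 0 < 0 → H 1 0 + deriv G 0 - 2 * τ < 0 →
        essentialSpectrum (linearization ε τ H G Uh Vh) ⊆ {lam : ℂ | lam.re < 0}) := by
  have key : essentialSpectrum (linearization ε τ H G Uh Vh)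
      = {lam : ℂ | ∃ k : ℝ, dispersion ε τ (H 1 0) (deriv G 0) lam k = 0} := by
    ext lam
    rw [essentialSpectrum, Set.mem_ofPred_eq, Set.mem_ofPred_eq,
      isFredholmIndexZero_shift_iff hε hτ hH hG hfront lam]
    push Not
    rfl
  refine ⟨key, fun h1 h2 h3 => ?_⟩
  rw [key]
  rintro lam ⟨k, hk⟩
  exact re_neg_of_dispersion_eq_zero hε hτ h1 h2 h3 hk
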